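/- For $c\in\mathbb{R}$ let $T_cf(x)=f(x-c)$ on $L^2(\mathbb{R})$, and let $\hat f(\gamma)=\int_{\mathbb{R}}f(x)e^{-2\pi i\gamma x}\,dx$, extended as usual to $L^2(\mathbb{R})$. Let $S\subset\mathbb{R}$ be measurable and let $\check L^2(S)$ be the space of all $f\in L^2(\mathbb{R})$ such that $\hat f=0$ a.e. outside $S$. For a measurable set $E\subset S$ let $\mathcal{D}_E$ be the set of all $f\in L^2(\mathbb{R})$ such that $\hat f\in L^\infty(\mathbb{R})$ and the (closed, essential) support of $\hat f$ is a compact subset of $S\setminus E$. Theorem. Let $J$ be a nonempty finite or countable index set, let $c_j>0$ and $g_j,h_j\in L^2(\mathbb{R})$ for $j\in J$, and suppose that $\{T_{c_jk}g_j\}_{k\in\mathbb{Z},j\in J}$ and $\{T_{c_jk}h_j\}_{k\in\mathbb{Z},j\in J}$ are Bessel sequences in $\check L^2(S)$ (in particular, their elements belong to $\check L^2(S)$). Suppose that they satisfy the dual $\alpha$-local integrability condition with respect to some measurable set $E\subset S$ whose closure has Lebesgue measure zero, that is, $$\sum_{j\in J}\sum_{m\in\mathbb{Z}}\frac1{c_j}\int_{\mathbb{R}}\left|\hat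 f(\gamma)\,\overline{\hat f(\gamma+c_j^{-1}m)\,\hat g_j(\gamma)}\,\hat h_j(\gamma+c_j^{-1}m)\right|d\gamma<\infty\qquad\text{for all } f\in\mathcal{D}_E.$$ Then $\{T_{c_jk}g_j\}$ and $\{T_{c_jk}h_j\}$ are dual frames for $\check L^2(S)$ (that is, both are frames for $\check L^2(S)$ and $f=\sum_{j\in J}\sum_{k\in\mathbb{Z}}\langle f,T_{c_jk}g_j\rangle T_{c_jk}h_j$, with unconditional convergence, for all $f\in\check L^2(S)$) if and only if, for every $\alpha\in\bigcup_{j\in J}c_j^{-1}\mathbb{Z}$, $$\sum_{j\in J:\ \alpha\in c_j^{-1}\mathbb{Z}}\frac1{c_j}\,\overline{\hat g_j(\gamma)}\,\hat h_j(\gamma+\alpha)=\delta_{\alpha,0}\,\chi_S(\gamma)\qquad\text{for a.e. }\gamma\in\mathbb{R},$$ where the series on the left converges absolutely for a.e. $\gamma$. -/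

import Mathlib

open MeasureTheory
open scoped ENNReal FourierTransform ComplexConjugate

noncomputable section

namespace GSI

/-- The Hilbert space `L²(ℝ)` of complex-valued functions, with Lebesgue measure. -/
abbrev L2 : Type := Lp (α := ℝ) ℂ 2 volume

/-- The translation operator `(T_a f)(x) = f (x - a)` on `L²(ℝ)`. -/
def translate (a : ℝ) (f : L2) : L2 :=
  Lp.compMeasurePreserving (fun x : ℝ => x - a) (measurePreserving_sub_right volume a) f

/-- The translation operator acts as expected on representatives. -/
theorem translate_ae (a : ℝ) (f : L2) : translate a f =ᵐ[volume] fun x => f (x - a) :=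
  Lp.coeFn_compMeasurePreserving f (measurePreserving_sub_right volume a)

/-- The Fourier transform on `L²(ℝ)` (normalised as `∫ f(x) exp (-2πiγx) dx` on Schwartz functions
and extended by density). A function is obtained from it by choosing a representative. -/
def hat (f : L2) : ℝ → ℂ := ((𝓕 f : L2) : ℝ → ℂ)

/-- The space of `f ∈ L²(ℝ)` whose Fourier transform is supported in `S`, that is,
vanishes almost everywhere outside `S`. -/
def L2check (S : Set ℝ) : Submodule ℂ L2 where
  carrier := {f | ∀ᵐ γ : ℝ, γ ∉ S → hat f γ = 0}
  zero_mem' := by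
    have h0 : (𝓕 (0 : L2) : L2) = 0 := (Lp.fourierTransformₗᵢ ℝ ℂ).map_zero
    have h1 := Lp.coeFn_zero ℂ 2 (volume : Measure ℝ)
    simp only [Set.mem_ofPred_eq, hat, h0]
    filter_upwards [h1] with γ hγ _
    rw [hγ]; rfl
  add_mem' := by
    intro f g hf hg
    have h0 : (𝓕 (f + g) : L2) = 𝓕 f + 𝓕 g := (Lp.fourierTransformₗᵢ ℝ ℂ).map_add f g
    have h1 := Lp.coeFn_add (𝓕 f : L2) (𝓕 g : L2)
    simp only [Set.mem_ofPred_eq, hat, h0] at hf hg ⊢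
    filter_upwards [h1, hf, hg] with γ hγ h2 h3 hS
    rw [hγ, Pi.add_apply, h2 hS, h3 hS, add_zero]
  smul_mem' := by
    intro a f hf
    have h0 : (𝓕 (a • f) : L2) = a • 𝓕 f := (Lp.fourierTransformₗᵢ ℝ ℂ).map_smul a f
    have h1 := Lp.coeFn_smul a (𝓕 f : L2)
    simp only [Set.mem_ofPred_eq, hat, h0] at hf ⊢
    filter_upwards [h1, hf] with γ hγ h2 hS
    rw [hγ, Pi.smul_apply, h2 hS, smul_zero]

/-- The family `𝓔` of exceptional sets: measurable subsets of `S` whose closure is null. -/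
def exceptionalSets (S : Set ℝ) : Set (Set ℝ) :=
  {E | MeasurableSet E ∧ E ⊆ S ∧ volume (closure E) = 0}

/-- The functions `f ∈ L²(ℝ)` with bounded Fourier transform whose (closed, essential) support is a
compact subset of `S \ E`. The support is such a set if and only if the Fourier transform vanishes
almost everywhere outside some compact `K ⊆ S \ E`. -/
def testFunctions (S E : Set ℝ) : Set L2 :=
  {f | MemLp (hat f) ∞ volume ∧
    ∃ K : Set ℝ, IsCompact K ∧ K ⊆ S \ E ∧ ∀ᵐ γ : ℝ, γ ∉ K → hat f γ = 0}

section Frames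

variable {H : Type*} [NormedAddCommGroup H] [InnerProductSpace ℂ H] {ι : Type*}

/-- `e` is a Bessel sequence in the subspace `V`. -/
def IsBessel (V : Submodule ℂ H) (e : ι → H) : Prop :=
  (∀ i, e i ∈ V) ∧ ∃ B : ℝ, 0 < B ∧ ∀ f ∈ V,
    Summable (fun i => ‖inner ℂ (e i) f‖ ^ 2) ∧ ∑' i, ‖inner ℂ (e i) f‖ ^ 2 ≤ B * ‖f‖ ^ 2

/-- `e` is a frame for the subspace `V`. -/
def IsFrame (V : Submodule ℂ H) (e : ι → H) : Prop :=
  (∀ i, e i ∈ V) ∧ ∃ A B : ℝ, 0 < A ∧ 0 < B ∧ ∀ f ∈ V,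
    Summable (fun i => ‖inner ℂ (e i) f‖ ^ 2) ∧
    A * ‖f‖ ^ 2 ≤ ∑' i, ‖inner ℂ (e i) f‖ ^ 2 ∧
    ∑' i, ‖inner ℂ (e i) f‖ ^ 2 ≤ B * ‖f‖ ^ 2

/-- `e` and `e'` are dual frames for `V`: both are frames for `V`, and every `f ∈ V` is the
(unconditionally convergent) sum `∑ ⟨f, e i⟩ e' i`. Mathlib's inner product is linear in the
second argument, so the coefficient `⟨f, e i⟩` is `inner ℂ (e i) f`. -/
def AreDualFrames (V : Submodule ℂ H) (e e' : ι → H) : Prop :=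
  IsFrame V e ∧ IsFrame V e' ∧ ∀ f ∈ V, HasSum (fun i => inner ℂ (e i) f • e' i) f

end Frames

section Systems

variable {J : Type*}

/-- The generalized shift-invariant system `{T_{c_j k} g_j}`, indexed by `(j, k) ∈ J × ℤ`. -/
def gsi (c : J → ℝ) (g : J → L2) : J × ℤ → L2 :=
  fun p => translate (c p.1 * (p.2 : ℝ)) (g p.1)

/-- The dual `α`-local integrability condition with respect to `E`. -/
def DualAlphaLIC (S E : Set ℝ) (c : J → ℝ) (g h : J → L2) : Prop :=
  ∀ f ∈ testFunctions S E,
    ∑' (j : J) (m : ℤ), ENNReal.ofReal (c j)⁻¹ *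
      ∫⁻ γ : ℝ, ‖hat f γ * conj (hat f (γ + (c j)⁻¹ * (m : ℝ)) * hat (g j) γ) *
        hat (h j) (γ + (c j)⁻¹ * (m : ℝ))‖ₑ < ∞

end Systems

/-- The lattice `c⁻¹ ℤ`. -/
def dualLattice (c : ℝ) : Set ℝ := Set.range fun m : ℤ => c⁻¹ * (m : ℝ)

end GSI

end

noncomputable section

namespace GSI

/-! ### Mixed frame operators of Bessel sequences. -/

section FrameOperator

variable {H : Type*} [NormedAddCommGroup H] [InnerProductSpace ℂ H] {ι : Type*}
  {V : Submodule ℂ H} {e e' : ι → H}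

/-! The mixed frame operator of two Bessel sequences is bounded, so duality means that it is the
identity. A bounded operator on a complex Hilbert space is determined by its quadratic form, so it
suffices to test on the diagonal of the dense set `testFunctions S E`
(`IsBessel.areDualFrames_iff`).

On the Fourier side, the numbers ⟨f, T_{ck}g⟩ are Fourier coefficients of a c⁻¹-periodization, and
Parseval turns the sum over k into a sum over shifts c⁻¹m (`exists_hasSum_crossTerm`). Local
integrability makes the sum over (j, m) absolutely convergent. Grouping by α = c_j⁻¹m gives the
expansion ∑_α ∫ f̂(γ) conj f̂(γ+α) t_α(γ) dγ (`hasSum_freqCoeff`), where t_α is the series of the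
theorem; the Bessel bounds control it through the Calderón sums.

If t_α = δ_{α,0} χ_S, the expansion collapses to ‖f‖². Conversely, replacing f by T_u f multiplies
the α-th coefficient by exp(2πiαu) while the total stays ‖f‖². Uniqueness of the coefficients of an
absolutely convergent series of characters isolates each frequency (`coeff_eq_of_hasSum_character`).
Polarization and indicator test functions then recover t_α almost everywhere. -/

theorem memℓp_two_of_summable_sq {a : ι → ℂ} (ha : Summable fun i => ‖a i‖ ^ 2) :
    Memℓp a 2 := by
  refine memℓp_gen ?_
  simpa using ha

/-- The coefficient map `f ↦ (⟨f, e i⟩)ᵢ` of a Bessel sequence, with values in `ℓ²`. -/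
def IsBessel.analysis (he : IsBessel V e) : V →L[ℂ] lp (fun _ : ι => ℂ) 2 :=
  LinearMap.mkContinuous
    { toFun := fun f => ⟨fun i => inner ℂ (e i) (f : H),
        memℓp_two_of_summable_sq (he.2.choose_spec.2 f f.2).1⟩
      map_add' := fun f k => by ext i; exact inner_add_right _ _ _
      map_smul' := fun a f => by ext i; exact inner_smul_right _ _ _ }
    (Real.sqrt he.2.choose) (fun f => by
      have h := (he.2.choose_spec.2 f f.2).2
      have hB := he.2.choose_spec.1
      refine le_of_sq_le_sq ?_ (by positivity)
      rw [mul_pow, Real.sq_sqrt hB.le]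
      refine le_trans (le_of_eq ?_) h
      have := lp.norm_rpow_eq_tsum (p := 2) (by norm_num)
        (⟨fun i => inner ℂ (e i) (f : H),
          memℓp_two_of_summable_sq (he.2.choose_spec.2 f f.2).1⟩ : lp (fun _ : ι => ℂ) 2)
      simpa using this)

theorem IsBessel.analysis_apply (he : IsBessel V e) (f : V) (i : ι) :
    he.analysis f i = inner ℂ (e i) (f : H) := rfl

theorem IsBessel.norm_analysis_sq (he : IsBessel V e) (f : V) :
    ‖he.analysis f‖ ^ 2 = ∑' i, ‖inner ℂ (e i) (f : H)‖ ^ 2 := by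
  have := lp.norm_rpow_eq_tsum (p := 2) (by norm_num) (he.analysis f)
  simpa [he.analysis_apply] using this

theorem IsBessel.hasSum_inner_analysis (he : IsBessel V e) (he' : IsBessel V e') (f k : V) :
    HasSum (fun i => inner ℂ (e i) (f : H) * inner ℂ (k : H) (e' i))
      (inner ℂ (he'.analysis k) (he.analysis f)) := by
  have := lp.hasSum_inner (𝕜 := ℂ) (he'.analysis k) (he.analysis f)
  simpa [he.analysis_apply, he'.analysis_apply] using this

theorem IsBessel.isFrame_of_norm_le (he : IsBessel V e) {A : ℝ} (hA : 0 < A)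
    (h : ∀ f : V, ‖f‖ ≤ A * ‖he.analysis f‖) : IsFrame V e := by
  obtain ⟨h1, B, hB, h2⟩ := id he
  refine ⟨h1, (A ^ 2)⁻¹, B, by positivity, hB, fun f hf => ⟨(h2 f hf).1, ?_, (h2 f hf).2⟩⟩
  have h3 := h ⟨f, hf⟩
  have h4 := he.norm_analysis_sq ⟨f, hf⟩
  simp only at h4
  rw [← h4, inv_mul_le_iff₀ (by positivity), ← mul_pow]
  exact pow_le_pow_left₀ (norm_nonneg _) h3 2

variable [CompleteSpace V]

/-- The mixed frame operator `f ↦ ∑ ⟨f, e i⟩ e' i`. -/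
def IsBessel.frameOp (he : IsBessel V e) (he' : IsBessel V e') : V →L[ℂ] V :=
  (ContinuousLinearMap.adjoint he'.analysis).comp he.analysis

theorem IsBessel.inner_frameOp (he : IsBessel V e) (he' : IsBessel V e') (f k : V) :
    inner ℂ k (he.frameOp he' f) = inner ℂ (he'.analysis k) (he.analysis f) := by
  simp [IsBessel.frameOp, ContinuousLinearMap.adjoint_inner_right]

theorem IsBessel.adjoint_analysis_single [DecidableEq ι] (he : IsBessel V e) (i : ι) (a : ℂ) :
    ContinuousLinearMap.adjoint he.analysis (lp.single 2 i a) = a • (⟨e i, he.1 i⟩ : V) := by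
  refine ext_inner_left ℂ fun v => ?_
  rw [ContinuousLinearMap.adjoint_inner_right, lp.inner_single_right, he.analysis_apply,
    inner_smul_right]
  simp

/-- An ℓ² sequence is the unconditional sum of its one-coordinate pieces, and the bounded synthesis
operator carries that sum to `V`. -/
theorem IsBessel.hasSum_frameOp (he : IsBessel V e) (he' : IsBessel V e') (f : V) :
    HasSum (fun i => inner ℂ (e i) (f : H) • e' i) (he.frameOp he' f : H) := by
  classical
  have h1 := lp.hasSum_single (p := 2) (by norm_num) (he.analysis f)
  have h2 := (V.subtypeL.comp (ContinuousLinearMap.adjoint he'.analysis)).hasSum h1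
  simpa [he'.adjoint_analysis_single, he.analysis_apply, IsBessel.frameOp] using h2

/-- Two Bessel sequences are dual frames as soon as the reproducing formula holds weakly, on the
diagonal of a dense set. -/
theorem IsBessel.areDualFrames_iff (he : IsBessel V e) (he' : IsBessel V e') {D : Set H}
    (hDV : D ⊆ V) (hVD : (V : Set H) ⊆ closure D) :
    AreDualFrames V e e' ↔ ∀ f ∈ D,
      HasSum (fun i => inner ℂ (e i) f * inner ℂ f (e' i)) ((‖f‖ : ℂ) ^ 2) := by
  constructor
  · rintro ⟨-, -, h⟩ f hf
    have := (innerSL ℂ f).hasSum (h f (hDV hf))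
    simpa [inner_smul_right, inner_self_eq_norm_sq_to_K] using this
  intro h
  have key : ∀ f : V, inner ℂ (he'.analysis f) (he.analysis f) = (inner ℂ f f : ℂ) := by
    let D' : Set V := Subtype.val ⁻¹' D
    have hD' : Dense D' := by
      intro x
      rw [closure_subtype]
      have : Subtype.val '' D' = D := by
        exact (Subtype.image_preimage_coe _ _).trans (Set.inter_eq_right.2 hDV)
      rw [this]
      exact hVD x.2
    refine fun f => congrFun (Continuous.ext_on hD' (f := fun f : V =>
      inner ℂ (he'.analysis f) (he.analysis f)) (g := fun f => (inner ℂ f f : ℂ))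
      (by fun_prop) (by fun_prop) ?_) f
    intro f hf
    have h1 := he.hasSum_inner_analysis he' f f
    have h2 := h f hf
    simp only
    rw [h1.unique h2, inner_self_eq_norm_sq_to_K]
    simp
  have hop : ∀ f : V, he.frameOp he' f = f := by
    have : (he.frameOp he' : V →ₗ[ℂ] V) = LinearMap.id := by
      refine (ext_inner_map _ _).1 fun f => ?_
      have h1 := he.inner_frameOp he' f f
      rw [key] at h1
      have h2 := congrArg conj h1
      rwa [inner_conj_symm, inner_conj_symm] at h2
    exact fun f => congrArg (fun L : V →ₗ[ℂ] V => L f) this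
  -- The lower frame bound of each system comes from the upper bound of the other, by
  -- Cauchy–Schwarz; the `+ 1` below only keeps the constant positive.
  have hnorm : ∀ f : V, ‖f‖ ^ 2 ≤ ‖he'.analysis f‖ * ‖he.analysis f‖ := by
    intro f
    have h1 := norm_inner_le_norm (𝕜 := ℂ) (he'.analysis f) (he.analysis f)
    rw [key, inner_self_eq_norm_sq_to_K] at h1
    simpa using h1
  have aux : ∀ {b : ι → H} (hb : IsBessel V b) (f : V) (x : ℝ), 0 ≤ x →
      ‖f‖ ^ 2 ≤ ‖hb.analysis f‖ * x → ‖f‖ ≤ (‖hb.analysis‖ + 1) * x := by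
    intro b hb f x hx h1
    rcases (norm_nonneg f).eq_or_lt with h0 | h0
    · rw [← h0]; positivity
    · refine le_of_mul_le_mul_left ?_ h0
      have h2 := hb.analysis.le_opNorm f
      nlinarith [mul_le_mul_of_nonneg_right h2 hx, mul_nonneg h0.le hx]
  refine ⟨he.isFrame_of_norm_le (A := ‖he'.analysis‖ + 1) (by positivity) fun f =>
    aux he' f _ (norm_nonneg _) (hnorm f), he'.isFrame_of_norm_le (A := ‖he.analysis‖ + 1)
    (by positivity) fun f => aux he f _ (norm_nonneg _) ((hnorm f).trans_eq (mul_comm _ _)), ?_⟩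
  intro f hf
  have := he.hasSum_frameOp he' ⟨f, hf⟩
  rwa [hop] at this

end FrameOperator

/-! ### Plancherel, and translation as modulation. -/

section Fourier

theorem hat_memLp (f : L2) : MemLp (hat f) 2 volume := Lp.memLp _

theorem exists_hat_ae_eq {F : ℝ → ℂ} (hF : MemLp F 2 volume) : ∃ f : L2, hat f =ᵐ[volume] F := by
  refine ⟨(Lp.fourierTransformₗᵢ ℝ ℂ).symm (hF.toLp F), ?_⟩
  have : (𝓕 ((Lp.fourierTransformₗᵢ ℝ ℂ).symm (hF.toLp F)) : L2) = hF.toLp F :=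
    (Lp.fourierTransformₗᵢ ℝ ℂ).apply_symm_apply _
  rw [hat, this]
  exact hF.coeFn_toLp

theorem inner_eq_integral_hat (f k : L2) : inner ℂ f k = ∫ γ, conj (hat f γ) * hat k γ := by
  rw [← Lp.inner_fourier_eq, L2.inner_def]
  simp [hat, mul_comm]

theorem norm_sq_eq_integral_hat (f : L2) : ((‖f‖ : ℂ) ^ 2) = ∫ γ, conj (hat f γ) * hat f γ := by
  rw [← inner_eq_integral_hat, inner_self_eq_norm_sq_to_K]
  simp

/-- The character `γ ↦ exp (2πiaγ)`. -/
def character (a γ : ℝ) : ℂ := Complex.exp (2 * Real.pi * Complex.I * a * γ)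

@[simp] theorem norm_character (a γ : ℝ) : ‖character a γ‖ = 1 := by
  rw [character, show (2 * Real.pi * Complex.I * a * γ : ℂ) =
    ((2 * Real.pi * a * γ : ℝ) : ℂ) * Complex.I by push_cast; ring, Complex.norm_exp_ofReal_mul_I]

@[fun_prop] theorem continuous_character (a : ℝ) : Continuous (character a) := by
  unfold character; fun_prop

theorem conj_character (a γ : ℝ) : conj (character a γ) = character (-a) γ := by
  rw [character, character, ← Complex.exp_conj]
  simp [map_ofNat]

theorem character_add (a γ β : ℝ) : character a (γ + β) = character a γ * character a β := by
  rw [character, character, character, ← Complex.exp_add]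
  push_cast; ring_nf

theorem character_neg_mul (a γ : ℝ) : character (-a) γ * character a γ = 1 := by
  rw [character, character, ← Complex.exp_add]
  simp

theorem character_comm (a γ : ℝ) : character a γ = character γ a := by
  rw [character, character]; ring_nf

@[simp] theorem character_zero (a : ℝ) : character a 0 = 1 := by simp [character]

theorem memLp_character_mul (a : ℝ) {p : ℝ≥0∞} {μ : Measure ℝ} {F : ℝ → ℂ} (hF : MemLp F p μ) :
    MemLp (fun γ => character a γ * F γ) p μ := by
  refine hF.of_le ((continuous_character a).aestronglyMeasurable.mul hF.1) (.of_forall fun γ => ?_)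
  simp

/-- Multiplication by a character on `L²(ℝ)`. -/
def modulate (a : ℝ) (f : L2) : L2 := (memLp_character_mul a (Lp.memLp f)).toLp _

theorem modulate_ae (a : ℝ) (f : L2) : modulate a f =ᵐ[volume] fun γ => character a γ * f γ :=
  MemLp.coeFn_toLp _

theorem isometry_modulate (a : ℝ) : Isometry (modulate a) := by
  refine Isometry.of_dist_eq fun f k => ?_
  rw [dist_eq_norm, dist_eq_norm]
  refine le_antisymm (Lp.norm_le_norm_of_ae_le ?_) (Lp.norm_le_norm_of_ae_le ?_)
  all_goals
    filter_upwards [Lp.coeFn_sub (modulate a f) (modulate a k), Lp.coeFn_sub f k,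
      modulate_ae a f, modulate_ae a k] with γ h1 h2 h3 h4
    rw [h1, h2, Pi.sub_apply, Pi.sub_apply, h3, h4, ← mul_sub]
    simp

theorem continuous_translate (a : ℝ) : Continuous (translate a) :=
  (Lp.isometry_compMeasurePreserving (measurePreserving_sub_right volume a)).continuous

/-- Both sides are continuous in `f`, so Schwartz functions suffice; there it is a change of
variables in the Fourier integral. -/
theorem fourier_translate (a : ℝ) (f : L2) : (𝓕 (translate a f) : L2) = modulate (-a) (𝓕 f) := by
  have h1 : Continuous fun f : L2 => (𝓕 (translate a f) : L2) :=
    (Lp.fourierTransformₗᵢ ℝ ℂ).continuous.comp (continuous_translate a)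
  have h2 : Continuous fun f : L2 => modulate (-a) (𝓕 f) :=
    (isometry_modulate (-a)).continuous.comp (Lp.fourierTransformₗᵢ ℝ ℂ).continuous
  refine congrFun (DenseRange.equalizer
    (SchwartzMap.denseRange_toLpCLM (F := ℂ) (E := ℝ) (p := 2) (μ := volume) (by norm_num))
    h1 h2 ?_) f
  funext φ
  simp only [Function.comp_apply, SchwartzMap.toLpCLM_apply]
  have h3 : translate a (φ.toLp 2) = (φ.compSubConstCLM ℂ a).toLp 2 := by
    refine Lp.ext ?_
    have h4 := (measurePreserving_sub_right volume a).quasiMeasurePreserving.ae_eq_comp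
      (φ.coeFn_toLp 2 volume)
    filter_upwards [translate_ae a (φ.toLp 2), h4,
      (φ.compSubConstCLM ℂ a).coeFn_toLp 2 volume] with x h5 h6 h7
    rw [h5, h7]
    exact h6
  rw [h3, SchwartzMap.toLp_fourier_eq, SchwartzMap.toLp_fourier_eq]
  refine Lp.ext ?_
  filter_upwards [(𝓕 (φ.compSubConstCLM ℂ a)).coeFn_toLp 2 volume,
    modulate_ae (-a) ((𝓕 φ).toLp 2), (𝓕 φ).coeFn_toLp 2 volume] with γ h5 h6 h7
  rw [h5, h6, h7, SchwartzMap.fourier_coe, SchwartzMap.fourier_coe]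
  rw [Real.fourier_real_eq_integral_exp_smul, Real.fourier_real_eq_integral_exp_smul,
    ← integral_const_mul,
    ← integral_sub_right_eq_self (fun v : ℝ => character (-a) γ * _) a]
  refine integral_congr_ae (.of_forall fun v => ?_)
  simp only [SchwartzMap.compSubConstCLM_apply, smul_eq_mul, ← mul_assoc, character]
  rw [← Complex.exp_add]
  congr 2
  push_cast
  ring

theorem hat_translate (a : ℝ) (f : L2) :
    hat (translate a f) =ᵐ[volume] fun γ => character (-a) γ * hat f γ := by
  rw [hat, fourier_translate]
  exact modulate_ae _ _

/-- The space is the kernel of a continuous map: the Fourier transform followed by restriction to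
the complement of `S`. -/
theorem isClosed_L2check {S : Set ℝ} (hS : MeasurableSet S) : IsClosed (L2check S : Set L2) := by
  let L := (LpToLpRestrictCLM ℝ ℂ ℂ volume 2 Sᶜ).comp
    ((Lp.fourierTransformₗᵢ ℝ ℂ).toContinuousLinearEquiv : L2 →L[ℂ] L2)
  have : (L2check S : Set L2) = L ⁻¹' {0} := by
    ext f
    have h1 : L f =ᵐ[volume.restrict Sᶜ] hat f := LpToLpRestrictCLM_coeFn ℂ Sᶜ (𝓕 f : L2)
    rw [Set.mem_preimage, Set.mem_singleton_iff, Lp.eq_zero_iff_ae_eq_zero]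
    have h2 : f ∈ (L2check S : Set L2) ↔ hat f =ᵐ[volume.restrict Sᶜ] 0 :=
      (ae_restrict_iff' (p := fun γ => hat f γ = 0) hS.compl).symm
    rw [h2]
    exact ⟨fun h => h1.trans h, fun h => h1.symm.trans h⟩
  rw [this]
  exact isClosed_singleton.preimage L.continuous

end Fourier

/-! ### Periodization and Parseval's identity. -/

section Parseval

/-- Parseval for the exponential basis of the circle of length `T`; the factor `T⁻¹` normalizes Haar
measure to mass one. -/
theorem hasSum_fourierCoeff_liftIoc {T : ℝ} [hT : Fact (0 < T)] {F G : ℝ → ℂ}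
    (hF : MemLp F 2 (volume.restrict (Set.Ioc 0 (0 + T))))
    (hG : MemLp G 2 (volume.restrict (Set.Ioc 0 (0 + T)))) :
    HasSum (fun n : ℤ => conj (fourierCoeff (AddCircle.liftIoc T 0 G) n) *
      fourierCoeff (AddCircle.liftIoc T 0 F) n)
      (T⁻¹ * ∫ x in Set.Ioc 0 (0 + T), conj (G x) * F x) := by
  have hF' := hF.memLp_liftIoc.haarAddCircle
  have hG' := hG.memLp_liftIoc.haarAddCircle
  have h := (fourierBasis (T := T)).hasSum_inner_mul_inner (hG'.toLp _) (hF'.toLp _)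
  have e1 : ∀ n, inner ℂ (fourierBasis n) (hF'.toLp _) =
      fourierCoeff (AddCircle.liftIoc T 0 F) n := fun n => by
    rw [← fourierCoeff_congr_ae hF'.coeFn_toLp, ← fourierBasis_repr,
      HilbertBasis.repr_apply_apply]
  have e2 : ∀ n, inner ℂ (hG'.toLp _) (fourierBasis n) =
      conj (fourierCoeff (AddCircle.liftIoc T 0 G) n) := fun n => by
    rw [← fourierCoeff_congr_ae hG'.coeFn_toLp, ← fourierBasis_repr,
      HilbertBasis.repr_apply_apply, inner_conj_symm]
  simp only [e1, e2] at h
  convert! h using 1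
  rw [L2.inner_def]
  have : ∫ t, inner ℂ (hG'.toLp _ t) (hF'.toLp _ t) ∂AddCircle.haarAddCircle =
      ∫ t, AddCircle.liftIoc T 0 (fun x => conj (G x) * F x) t ∂AddCircle.haarAddCircle := by
    refine integral_congr_ae ?_
    filter_upwards [hF'.coeFn_toLp, hG'.coeFn_toLp] with t h1 h2
    rw [h1, h2]
    simp [AddCircle.liftIoc, mul_comm]
  rw [this, AddCircle.integral_haarAddCircle, AddCircle.integral_liftIoc_eq_intervalIntegral,
    intervalIntegral.integral_of_le (by linarith [hT.out])]
  simp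

theorem fourierCoeff_liftIoc_eq_setIntegral {T : ℝ} [hT : Fact (0 < T)] (F : ℝ → ℂ) (n : ℤ) :
    fourierCoeff (AddCircle.liftIoc T 0 F) n =
      (T⁻¹ : ℝ) * ∫ x in Set.Ioc 0 (0 + T), character (-(T⁻¹ * n)) x * F x := by
  rw [fourierCoeff_liftIoc_eq, fourierCoeffOn_eq_integral,
    intervalIntegral.integral_of_le (by linarith [hT.out])]
  simp only [fourier_coe_apply, character]
  simp
  left
  refine integral_congr_ae (.of_forall fun x => ?_)
  simp only
  congr 2
  ring

theorem hasSum_setIntegral_add_zsmul {T : ℝ} (hT : 0 < T) {F : ℝ → ℂ} (hF : Integrable F) :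
    HasSum (fun n : ℤ => ∫ x in Set.Ioc 0 (0 + T), F (x + T * n)) (∫ x, F x) := by
  have h := hasSum_integral_iUnion (μ := volume) (f := F)
    (s := fun n : ℤ => Set.Ioc (0 + n • T) (0 + (n + 1) • T))
    (fun n => measurableSet_Ioc) (Set.pairwise_disjoint_Ioc_add_zsmul 0 T)
    hF.integrableOn
  rw [iUnion_Ioc_add_zsmul hT, setIntegral_univ] at h
  convert! h using 2 with n
  have h1 := (measurePreserving_add_right volume (T * n)).setIntegral_preimage_emb
    (measurableEmbedding_addRight _) F (Set.Ioc (0 + n • T) (0 + (n + 1) • T))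
  rw [← h1]
  congr 2
  ext x
  simp only [Set.mem_Ioc, Set.mem_preimage, zsmul_eq_mul]
  push_cast
  constructor <;> rintro ⟨_, _⟩ <;> constructor <;> nlinarith

theorem character_mul_int {c : ℝ} (hc : 0 < c) (k n : ℤ) : character (c * k) (c⁻¹ * n) = 1 := by
  rw [character, Complex.exp_eq_one_iff]
  refine ⟨k * n, ?_⟩
  have : (c : ℂ) ≠ 0 := by exact_mod_cast hc.ne'
  push_cast
  field_simp

/-- Only finitely many shifts of a bounded support meet one period, so the periodizations below are
finite sums. -/
theorem exists_finset_forall_add_eq_zero {T : ℝ} (hT : 0 < T) (R : ℝ) :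
    ∃ s : Finset ℤ, ∀ n ∉ s, ∀ x ∈ Set.Ioc 0 (0 + T), R < |x + T * n| := by
  obtain ⟨N, hN⟩ := exists_nat_gt (R / T + 1)
  refine ⟨Finset.Icc (-N) N, fun n hn x hx => ?_⟩
  have hRN : R + T < T * N := by
    rw [div_add_one hT.ne', div_lt_iff₀ hT] at hN
    linarith
  rw [zero_add] at hx
  rw [Finset.mem_Icc, not_and_or, not_le, not_le] at hn
  rcases hn with hn | hn
  · have h1 : (n : ℝ) < -N := by exact_mod_cast hn
    rw [lt_abs]; right
    nlinarith [hx.2, mul_lt_mul_of_pos_left h1 hT]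
  · have h1 : (N : ℝ) < n := by exact_mod_cast hn
    rw [lt_abs]; left
    nlinarith [hx.1, mul_lt_mul_of_pos_left h1 hT]

theorem memLp_comp_add {F : ℝ → ℂ} {p : ℝ≥0∞} (hF : MemLp F p volume) (a : ℝ) :
    MemLp (fun x => F (x + a)) p volume :=
  hF.comp_measurePreserving (measurePreserving_add_right volume a)

theorem integrable_of_memLp_two_of_bounded_support {F : ℝ → ℂ} (hF : MemLp F 2 volume) {R : ℝ}
    (hR : ∀ x, R < |x| → F x = 0) : Integrable F := by
  rw [← memLp_one_iff_integrable]
  refine hF.mono_exponent_of_measure_support_ne_top (s := Set.Icc (-R) R) (fun x hx => ?_)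
    (by simp) (by norm_num)
  refine hR x (not_le.1 fun h => hx (abs_le.1 h))

/-- Parseval's identity for the coefficients `∫ exp (2πickγ) F(γ) dγ`: they are the Fourier
coefficients of the `c⁻¹`-periodization of `F`. -/
theorem exists_hasSum_periodization {c : ℝ} (hc : 0 < c) {F G : ℝ → ℂ}
    (hF : MemLp F 2 volume) (hG : MemLp G 2 volume) {R : ℝ}
    (hFR : ∀ x, R < |x| → F x = 0) (hGR : ∀ x, R < |x| → G x = 0) :
    ∃ X : ℂ, HasSum (fun k : ℤ => (∫ γ, character (c * k) γ * F γ) *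
        conj (∫ γ, character (c * k) γ * G γ)) X ∧
      HasSum (fun m : ℤ => ((c⁻¹ : ℝ) : ℂ) * ∫ γ, F γ * conj (G (γ + c⁻¹ * m))) X := by
  have hT : 0 < c⁻¹ := inv_pos.2 hc
  have : Fact (0 < c⁻¹) := ⟨hT⟩
  have hc' : (c : ℂ) ≠ 0 := by exact_mod_cast hc.ne'
  obtain ⟨s, hs⟩ := exists_finset_forall_add_eq_zero hT R
  let I := Set.Ioc 0 (0 + c⁻¹)
  let P (F : ℝ → ℂ) (x : ℝ) : ℂ := ∑ n ∈ s, F (x + c⁻¹ * n)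
  have hP : ∀ {F : ℝ → ℂ}, MemLp F 2 volume → MemLp (P F) 2 (volume.restrict I) := fun hF =>
    (memLp_finsetSum s fun n _ => memLp_comp_add hF _).restrict I
  have hcoef : ∀ {F : ℝ → ℂ}, MemLp F 2 volume → (∀ x, R < |x| → F x = 0) → ∀ k : ℤ,
      ∫ γ, character (c * k) γ * F γ = ∫ x in I, character (c * k) x * P F x := by
    intro F hF hFR k
    have hint : ∀ n : ℤ, Integrable fun x => character (c * k) x * F (x + c⁻¹ * n) := fun n => by
      rw [← memLp_one_iff_integrable]
      refine memLp_character_mul _ (memLp_comp_add (memLp_one_iff_integrable.2 ?_) _)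
      exact integrable_of_memLp_two_of_bounded_support hF hFR
    have h1 := hasSum_setIntegral_add_zsmul hT (F := fun γ => character (c * k) γ * F γ)
      (by simpa using hint 0)
    simp only [character_add, character_mul_int hc, mul_one] at h1
    refine h1.unique ?_
    have h2 : ∫ x in I, character (c * k) x * P F x =
        ∑ n ∈ s, ∫ x in I, character (c * k) x * F (x + c⁻¹ * n) := by
      simp only [P, Finset.mul_sum]
      exact integral_finsetSum s fun n _ => (hint n).integrableOn
    rw [h2]
    refine hasSum_sum_of_ne_finset_zero fun n hn => setIntegral_eq_zero_of_forall_eq_zero ?_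
    intro x hx
    rw [hFR _ (hs n hn x hx), mul_zero]
  refine ⟨c⁻¹ * ∫ x in I, P F x * conj (P G x), ?_, ?_⟩
  · have hI : Set.Ioc 0 (0 + c⁻¹) = I := rfl
    -- The characters in the claim carry the sign opposite to that of Fourier coefficients, hence
    -- the reindexing `k ↦ -k`. Each coefficient carries a factor `c`, which `c⁻¹ ^ 2` removes.
    have h1 := (Equiv.neg ℤ).hasSum_iff.2 (hasSum_fourierCoeff_liftIoc (hP hF) (hP hG))
    have h2 := h1.mul_left ((c : ℂ)⁻¹ ^ 2)
    convert! h2 using 1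
    · funext k
      rw [hcoef hF hFR, hcoef hG hGR]
      simp only [Function.comp_apply, Equiv.neg_apply, fourierCoeff_liftIoc_eq_setIntegral, inv_inv,
        Int.cast_neg, mul_neg, neg_neg, map_mul, Complex.conj_ofReal, hI]
      field_simp
    · simp only [mul_comm (P F _), hI]
      push_cast
      field_simp
  · have hint : ∀ n n' : ℤ, Integrable fun x => F (x + c⁻¹ * n) * conj (G (x + c⁻¹ * n')) :=
      fun n n' => (memLp_comp_add hF _).integrable_mul (memLp_comp_add hG _).star
    let A (p : ℤ × ℤ) : ℂ := ∫ x in I, F (x + c⁻¹ * p.1) * conj (G (x + c⁻¹ * p.2))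
    have hA : HasSum A (∫ x in I, P F x * conj (P G x)) := by
      have : ∫ x in I, P F x * conj (P G x) = ∑ p ∈ s ×ˢ s, A p := by
        simp only [P, map_sum, Finset.sum_mul_sum, ← Finset.sum_product', A]
        exact integral_finsetSum _ fun p _ => (hint p.1 p.2).integrableOn
      rw [this]
      refine hasSum_sum_of_ne_finset_zero fun p hp => setIntegral_eq_zero_of_forall_eq_zero ?_
      intro x hx
      rw [Finset.mem_product, not_and_or] at hp
      rcases hp with hp | hp
      · rw [hFR _ (hs _ hp x hx), zero_mul]
      · rw [hGR _ (hs _ hp x hx), map_zero, mul_zero]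
    -- Reindexing by the difference `m` of the two shifts: for fixed `m`, summing over the first
    -- shift unfolds the integral over one period to the whole line.
    let e : ℤ × ℤ ≃ ℤ × ℤ :=
      { toFun := fun p => (p.2, p.2 + p.1)
        invFun := fun p => (p.2 - p.1, p.1)
        left_inv := fun p => by ext <;> simp
        right_inv := fun p => by ext <;> simp }
    have h1 := (e.hasSum_iff.2 hA).prod_fiberwise
      (g := fun m : ℤ => ∫ γ, F γ * conj (G (γ + c⁻¹ * m))) fun m => by
        have h2 := hasSum_setIntegral_add_zsmul hT (by simpa using hint 0 m)
        convert! h2 using 2 with n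
        simp only [Function.comp_apply, A, e, Equiv.coe_fn_mk, Int.cast_add]
        refine integral_congr_ae (.of_forall fun x => ?_)
        simp only
        ring_nf
    have := h1.mul_left (((c⁻¹ : ℝ) : ℂ))
    simpa using this

end Parseval

/-! ### Cross terms and the Calderón bound. -/

section CrossTerms

/-- The summand of the local integrability condition, with the sign kept. -/
def crossTerm (c : ℝ) (f g h : L2) (m : ℤ) : ℂ :=
  ((c⁻¹ : ℝ) : ℂ) * ∫ γ, hat f γ * conj (hat f (γ + c⁻¹ * m) * hat g γ) * hat h (γ + c⁻¹ * m)

theorem ae_add_right {p : ℝ → Prop} (hp : ∀ᵐ γ : ℝ, p γ) (a : ℝ) : ∀ᵐ γ : ℝ, p (γ + a) :=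
  (measurePreserving_add_right volume a).quasiMeasurePreserving.ae hp

/-- Summation over the translates by `cℤ` of one pair of generators. -/
theorem exists_hasSum_crossTerm {c : ℝ} (hc : 0 < c) {f : L2} (g h : L2)
    (hf : MemLp (hat f) ∞ volume) {R : ℝ} (hR : ∀ᵐ γ : ℝ, R < |γ| → hat f γ = 0) :
    ∃ X : ℂ, HasSum (fun k : ℤ => inner ℂ (translate (c * k) g) f *
        inner ℂ f (translate (c * k) h)) X ∧ HasSum (crossTerm c f g h) X := by
  -- Truncation makes the support bound hold everywhere instead of almost everywhere.
  let Q (g : L2) : ℝ → ℂ := (Set.Icc (-R) R).indicator fun γ => hat f γ * conj (hat g γ)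
  have hQ2 : ∀ g, MemLp (Q g) 2 volume := fun g =>
    (MemLp.mul (hat_memLp g).star hf).indicator measurableSet_Icc
  have hQR : ∀ g x, R < |x| → Q g x = 0 := fun g x hx =>
    Set.indicator_of_notMem (s := Set.Icc (-R) R) (fun h => (abs_le.2 h).not_gt hx) _
  have hQ : ∀ g, Q g =ᵐ[volume] fun γ => hat f γ * conj (hat g γ) := fun g => by
    filter_upwards [hR] with γ hγ
    by_cases h : R < |γ|
    · rw [hQR g γ h, hγ h, zero_mul]
    · exact Set.indicator_of_mem (s := Set.Icc (-R) R) (abs_le.1 (not_lt.1 h)) _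
  have hinner : ∀ (g : L2) (k : ℤ),
      inner ℂ (translate (c * k) g) f = ∫ γ, character (c * k) γ * Q g γ := fun g k => by
    rw [inner_eq_integral_hat]
    refine integral_congr_ae ?_
    filter_upwards [hat_translate (c * k) g, hQ g] with γ h1 h2
    rw [h1, h2, map_mul, conj_character, neg_neg]
    ring
  obtain ⟨X, h1, h2⟩ := exists_hasSum_periodization hc (hQ2 g) (hQ2 h) (hQR g) (hQR h)
  refine ⟨X, ?_, ?_⟩
  · convert! h1 using 2 with k
    rw [← hinner, ← hinner, inner_conj_symm]
  · convert! h2 using 2 with m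
    rw [crossTerm]
    congr 1
    refine integral_congr_ae ?_
    filter_upwards [hQ g, ae_add_right (hQ h) (c⁻¹ * m)] with γ h3 h4
    rw [h3, h4]
    simp only [map_mul, Complex.conj_conj]
    ring

theorem hat_eq_zero_of_gsi_mem {J : Type*} {S : Set ℝ} {c : J → ℝ} {g : J → L2}
    (h : ∀ p, gsi c g p ∈ L2check S) (j : J) : ∀ᵐ γ : ℝ, γ ∉ S → hat (g j) γ = 0 := by
  have h1 : ∀ᵐ γ : ℝ, γ ∉ S → hat (gsi c g (j, 0)) γ = 0 := h (j, 0)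
  filter_upwards [h1, hat_translate (c j * (0 : ℤ)) (g j)] with γ h2 h3 hγ
  have h4 := h2 hγ
  rw [gsi, h3] at h4
  refine (mul_eq_zero.1 h4).resolve_left fun h => ?_
  have := norm_character (-(c j * (0 : ℤ))) γ
  rw [h] at this
  simp at this

theorem memLp_indicator_one {A : Set ℝ} (hA : MeasurableSet A) (hA' : volume A ≠ ∞) {p : ℝ≥0∞} :
    MemLp (A.indicator fun _ => (1 : ℂ)) p volume :=
  memLp_indicator_const p hA 1 (Or.inr hA')

theorem norm_sq_of_hat_eq_indicator {A : Set ℝ} (hA : MeasurableSet A) {f : L2}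
    (hf : hat f =ᵐ[volume] A.indicator fun _ => (1 : ℂ)) : ‖f‖ ^ 2 = volume.real A := by
  have h := norm_sq_eq_integral_hat f
  have h1 : ∫ γ, conj (hat f γ) * hat f γ = ∫ γ, A.indicator (fun _ => (1 : ℂ)) γ := by
    refine integral_congr_ae ?_
    filter_upwards [hf] with γ hγ
    rw [hγ]
    by_cases h : γ ∈ A <;> simp [h]
  rw [h1, integral_indicator hA, setIntegral_const] at h
  simp only [Complex.real_smul, mul_one] at h
  exact_mod_cast h

/-- If `f̂` is the indicator of a subset of an interval no longer than `c⁻¹`, the periodization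
has no overlaps. -/
theorem hasSum_norm_inner_sq_of_indicator {c : ℝ} (hc : 0 < c) {a b : ℝ} (hab : b - a ≤ c⁻¹)
    {A : Set ℝ} (hA : MeasurableSet A) (hAab : A ⊆ Set.Ioc a b) {f : L2} (g : L2)
    (hf : hat f =ᵐ[volume] A.indicator fun _ => (1 : ℂ)) :
    HasSum (fun k : ℤ => ‖inner ℂ (translate (c * k) g) f‖ ^ 2)
      (∫ γ in A, c⁻¹ * ‖hat g γ‖ ^ 2) := by
  have hA' : volume A ≠ ∞ := measure_ne_top_of_subset hAab (by simp)
  have hfR : ∀ᵐ γ : ℝ, max |a| |b| < |γ| → hat f γ = 0 := by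
    filter_upwards [hf] with γ hγ hlt
    rw [hγ]
    refine Set.indicator_of_notMem (fun h => ?_) _
    have := hAab h
    exact absurd (abs_le_max_abs_abs this.1.le this.2) (not_le.2 hlt)
  obtain ⟨X, h1, h2⟩ := exists_hasSum_crossTerm hc g g
    ((memLp_congr_ae hf).2 (memLp_indicator_one hA hA')) hfR
  -- Two points of `A` differ by less than `c⁻¹`, so `A` is disjoint from its shifts by nonzero
  -- multiples of `c⁻¹`.
  have h3 : ∀ m : ℤ, m ≠ 0 → crossTerm c f g g m = 0 := by
    intro m hm
    rw [crossTerm, integral_eq_zero_of_ae, mul_zero]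
    filter_upwards [hf, ae_add_right hf (c⁻¹ * m)] with γ h3 h4
    rw [h3, h4]
    by_cases h5 : γ ∈ A
    · have h6 : γ + c⁻¹ * m ∉ A := fun h6 => by
        obtain ⟨h7, h8⟩ := hAab h5
        obtain ⟨h9, h10⟩ := hAab h6
        have hT : 0 < c⁻¹ := inv_pos.2 hc
        rcases hm.lt_or_gt with hm | hm
        · have : (m : ℝ) ≤ -1 := by exact_mod_cast Int.le_sub_one_of_lt hm
          nlinarith
        · have : (1 : ℝ) ≤ m := by exact_mod_cast hm
          nlinarith
      simp [h6]
    · simp [h5]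
  have h4 : X = ((∫ γ in A, c⁻¹ * ‖hat g γ‖ ^ 2 : ℝ) : ℂ) := by
    rw [h2.unique (hasSum_single 0 h3), crossTerm, ← integral_complex_ofReal,
      ← integral_const_mul, ← integral_indicator hA]
    refine integral_congr_ae ?_
    filter_upwards [hf] with γ h5
    simp only [Int.cast_zero, mul_zero, add_zero, h5]
    by_cases h : γ ∈ A
    · simp [h, Complex.conj_mul']
    · simp [h]
  rw [h4] at h1
  rw [← Complex.hasSum_ofReal]
  convert! h1 using 2 with k
  rw [← inner_conj_symm f, Complex.mul_conj']
  push_cast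
  rfl

variable {J : Type*} [Countable J] {S : Set ℝ} {c : J → ℝ} {g h : J → L2}

/-- The Bessel property bounds the Calderón sum. -/
theorem IsBessel.exists_forall_sum_le (hS : MeasurableSet S) (hc : ∀ j, 0 < c j)
    (hg : IsBessel (L2check S) (gsi c g)) :
    ∃ B : ℝ, ∀ᵐ γ : ℝ, ∀ s : Finset J, ∑ j ∈ s, (c j)⁻¹ * ‖hat (g j) γ‖ ^ 2 ≤ B := by
  obtain ⟨hmem, B, hB, hbd⟩ := hg
  refine ⟨B, ae_all_iff.2 fun s => ?_⟩
  -- On intervals of length `ℓ` no periodization with `j ∈ s` overlaps. The bound is then tested on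
  -- indicators of subsets of `S` inside each such interval, and the constant `B` does not depend on
  -- `s`.
  obtain ⟨ℓ, hℓ, hℓs⟩ : ∃ ℓ : ℝ, 0 < ℓ ∧ ∀ j ∈ s, ℓ ≤ (c j)⁻¹ := by
    rcases s.eq_empty_or_nonempty with rfl | hs
    · exact ⟨1, one_pos, by simp⟩
    · refine ⟨s.inf' hs fun j => (c j)⁻¹, ?_, fun j hj => Finset.inf'_le _ hj⟩
      exact (Finset.lt_inf'_iff _).2 fun j _ => inv_pos.2 (hc j)
  have hint : ∀ j, Integrable fun γ => (c j)⁻¹ * ‖hat (g j) γ‖ ^ 2 := fun j =>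
    ((hat_memLp (g j)).integrable_norm_pow (by norm_num)).const_mul _
  have hpiece : ∀ n : ℤ, ∀ᵐ γ ∂volume.restrict (S ∩ Set.Ioc (0 + n • ℓ) (0 + (n + 1) • ℓ)),
      ∑ j ∈ s, (c j)⁻¹ * ‖hat (g j) γ‖ ^ 2 ≤ B := by
    intro n
    have hMI : volume (S ∩ Set.Ioc (0 + n • ℓ) (0 + (n + 1) • ℓ)) ≠ ∞ :=
      measure_ne_top_of_subset Set.inter_subset_right (by simp)
    have : IsFiniteMeasure (volume.restrict (S ∩ Set.Ioc (0 + n • ℓ) (0 + (n + 1) • ℓ))) :=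
      ⟨by rw [Measure.restrict_apply_univ]; exact hMI.lt_top⟩
    refine ae_le_of_forall_setIntegral_le (integrable_finsetSum s fun j _ => (hint j).restrict)
      (integrable_const B) fun A hA _ => ?_
    rw [Measure.restrict_restrict hA]
    set A' := A ∩ (S ∩ Set.Ioc (0 + n • ℓ) (0 + (n + 1) • ℓ)) with hA'
    have hA'm : MeasurableSet A' := hA.inter (hS.inter measurableSet_Ioc)
    have hA'f : volume A' ≠ ∞ := measure_ne_top_of_subset Set.inter_subset_right hMI
    obtain ⟨f, hf⟩ := exists_hat_ae_eq (memLp_indicator_one hA'm hA'f (p := 2))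
    have hfV : f ∈ L2check S := by
      change ∀ᵐ γ : ℝ, γ ∉ S → hat f γ = 0
      filter_upwards [hf] with γ hγ hγS
      rw [hγ]
      exact Set.indicator_of_notMem (fun h => hγS h.2.1) _
    obtain ⟨hsum, hle⟩ := hbd f hfV
    have h1 : ∀ j ∈ s, HasSum (fun k : ℤ => ‖inner ℂ (gsi c g (j, k)) f‖ ^ 2)
        (∫ γ in A', (c j)⁻¹ * ‖hat (g j) γ‖ ^ 2) := fun j hj =>
      hasSum_norm_inner_sq_of_indicator (hc j) (a := 0 + n • ℓ) (b := 0 + (n + 1) • ℓ)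
        (by simp only [add_smul, one_smul]; linarith [hℓs j hj]) hA'm
        (fun γ hγ => hγ.2.2) (g j) hf
    calc ∫ γ in A', ∑ j ∈ s, (c j)⁻¹ * ‖hat (g j) γ‖ ^ 2
        = ∑ j ∈ s, ∫ γ in A', (c j)⁻¹ * ‖hat (g j) γ‖ ^ 2 :=
          integral_finsetSum s fun j _ => (hint j).integrableOn
      _ = ∑ j ∈ s, ∑' k : ℤ, ‖inner ℂ (gsi c g (j, k)) f‖ ^ 2 :=
          Finset.sum_congr rfl fun j hj => (h1 j hj).tsum_eq.symm
      _ ≤ ∑' j, ∑' k : ℤ, ‖inner ℂ (gsi c g (j, k)) f‖ ^ 2 :=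
          hsum.prod.sum_le_tsum s fun j _ => tsum_nonneg fun k => sq_nonneg _
      _ = ∑' p, ‖inner ℂ (gsi c g p) f‖ ^ 2 := hsum.tsum_prod.symm
      _ ≤ B * ‖f‖ ^ 2 := hle
      _ = ∫ γ in A', B := by
          rw [norm_sq_of_hat_eq_indicator hA'm hf, setIntegral_const, smul_eq_mul, mul_comm]
  have hall : ∀ᵐ γ : ℝ, ∀ n : ℤ, γ ∈ S ∩ Set.Ioc (0 + n • ℓ) (0 + (n + 1) • ℓ) →
      ∑ j ∈ s, (c j)⁻¹ * ‖hat (g j) γ‖ ^ 2 ≤ B :=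
    ae_all_iff.2 fun n => (ae_restrict_iff' (hS.inter measurableSet_Ioc)).1 (hpiece n)
  filter_upwards [hall, ae_all_iff.2 (hat_eq_zero_of_gsi_mem hmem)] with γ h1 h2
  by_cases hγ : γ ∈ S
  · have h3 : γ ∈ ⋃ n : ℤ, Set.Ioc (0 + n • ℓ) (0 + (n + 1) • ℓ) := by
      rw [iUnion_Ioc_add_zsmul hℓ]; trivial
    obtain ⟨n, hn⟩ := Set.mem_iUnion.1 h3
    exact h1 n ⟨hγ, hn⟩
  · rw [Finset.sum_eq_zero fun j _ => by rw [h2 j hγ]; simp]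
    exact hB.le

end CrossTerms

/-! ### Test functions: separation and density. -/

section TestFunctions

open Filter Topology

/-- By inner regularity, a nonzero set of positive measure would contain a compact set of positive
measure. -/
theorem ae_eq_zero_of_forall_isCompact {M : Set ℝ} (hM : MeasurableSet M) {t : ℝ → ℂ}
    (ht : AEStronglyMeasurable t volume)
    (h : ∀ K ⊆ M, IsCompact K → t =ᵐ[volume.restrict K] 0) : ∀ᵐ γ : ℝ, γ ∈ M → t γ = 0 := by
  set t' := ht.mk t
  have ht' : t =ᵐ[volume] t' := ht.ae_eq_mk
  let Z := M ∩ {γ | t' γ ≠ 0}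
  have hZ : MeasurableSet Z :=
    hM.inter ((ht.stronglyMeasurable_mk.measurable (measurableSet_singleton 0)).compl)
  have hZ0 : volume Z = 0 := by
    by_contra hne
    obtain ⟨K, hKZ, hK, hKpos⟩ := hZ.exists_lt_isCompact (pos_iff_ne_zero.2 hne)
    have h1 := h K (hKZ.trans Set.inter_subset_left) hK
    have h2 : ∀ᵐ γ ∂volume.restrict K, False := by
      filter_upwards [h1, ae_restrict_of_ae ht', ae_restrict_mem hK.measurableSet] with γ h3 h4 h5
      exact (hKZ h5).2 (h4 ▸ h3)
    have h3 : volume.restrict K = 0 := by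
      rwa [eventually_false_iff_eq_bot, ae_eq_bot] at h2
    rw [Measure.restrict_eq_zero] at h3
    exact hKpos.ne' h3
  have h1 : ∀ᵐ γ : ℝ, γ ∉ Z := measure_eq_zero_iff_ae_notMem.1 hZ0
  filter_upwards [h1, ht'] with γ h2 h3 hγ
  rw [h3]
  by_contra h4
  exact h2 ⟨hγ, h4⟩

theorem ae_eq_zero_of_forall_setIntegral_subset_isCompact {M : Set ℝ} (hM : MeasurableSet M)
    {t : ℝ → ℂ} (ht : LocallyIntegrable t volume)
    (h : ∀ K ⊆ M, IsCompact K → ∀ A ⊆ K, MeasurableSet A → ∫ γ in A, t γ = 0) :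
    ∀ᵐ γ : ℝ, γ ∈ M → t γ = 0 := by
  refine ae_eq_zero_of_forall_isCompact hM ht.aestronglyMeasurable fun K hKM hK => ?_
  refine Integrable.ae_eq_zero_of_forall_setIntegral_eq_zero (ht.integrableOn_isCompact hK)
    fun s hs _ => ?_
  rw [Measure.restrict_restrict hs]
  exact h K hKM hK _ Set.inter_subset_right (hs.inter hK.measurableSet)

variable {S E : Set ℝ}

theorem mem_testFunctions_of_hat_ae_eq_indicator {K A : Set ℝ} (hK : IsCompact K)
    (hKS : K ⊆ S \ E) (hA : MeasurableSet A) (hAK : A ⊆ K) {f : L2}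
    (hf : hat f =ᵐ[volume] A.indicator fun _ => (1 : ℂ)) : f ∈ testFunctions S E := by
  refine ⟨(memLp_congr_ae hf).2 (memLp_indicator_one hA
    (measure_ne_top_of_subset hAK hK.measure_lt_top.ne)), K, hK, hKS, ?_⟩
  filter_upwards [hf] with γ hγ hγK
  rw [hγ]
  exact Set.indicator_of_notMem (fun h => hγK (hAK h)) _

theorem hat_add (f k : L2) : hat (f + k) =ᵐ[volume] fun γ => hat f γ + hat k γ := by
  have h0 : (𝓕 (f + k) : L2) = 𝓕 f + 𝓕 k := (Lp.fourierTransformₗᵢ ℝ ℂ).map_add f k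
  rw [hat, h0]
  exact Lp.coeFn_add _ _

theorem hat_smul (a : ℂ) (f : L2) : hat (a • f) =ᵐ[volume] fun γ => a * hat f γ := by
  have h0 : (𝓕 (a • f) : L2) = a • 𝓕 f := (Lp.fourierTransformₗᵢ ℝ ℂ).map_smul a f
  rw [hat, h0]
  exact Lp.coeFn_smul _ _

theorem hat_zero : hat 0 =ᵐ[volume] 0 := by
  have h0 : (𝓕 (0 : L2) : L2) = 0 := (Lp.fourierTransformₗᵢ ℝ ℂ).map_zero
  rw [hat, h0]
  exact Lp.coeFn_zero _ _ _

/-- The test functions form a linear subspace. -/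
def testSubmodule (S E : Set ℝ) : Submodule ℂ L2 where
  carrier := testFunctions S E
  zero_mem' := by
    refine ⟨(memLp_congr_ae hat_zero).2 MemLp.zero, ∅, isCompact_empty, Set.empty_subset _, ?_⟩
    filter_upwards [hat_zero] with γ hγ _ using hγ
  add_mem' := by
    rintro f k ⟨hf, K, hK, hKS, hfK⟩ ⟨hk, K', hK', hKS', hkK⟩
    refine ⟨(memLp_congr_ae (hat_add f k)).2 (hf.add hk), K ∪ K', hK.union hK',
      Set.union_subset hKS hKS', ?_⟩
    filter_upwards [hat_add f k, hfK, hkK] with γ h1 h2 h3 h4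
    rw [Set.mem_union, not_or] at h4
    rw [h1, h2 h4.1, h3 h4.2, add_zero]
  smul_mem' := by
    rintro a f ⟨hf, K, hK, hKS, hfK⟩
    refine ⟨(memLp_congr_ae (hat_smul a f)).2 (hf.const_mul a), K, hK, hKS, ?_⟩
    filter_upwards [hat_smul a f, hfK] with γ h1 h2 h3
    rw [h1, h2 h3, mul_zero]

theorem testFunctions_subset_L2check : testFunctions S E ⊆ (L2check S : Set L2) := by
  rintro f ⟨-, K, -, hKS, hfK⟩
  change ∀ᵐ γ : ℝ, γ ∉ S → hat f γ = 0
  filter_upwards [hfK] with γ h1 h2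
  exact h1 fun h => h2 (hKS h).1

theorem exists_ae_hat_eq_zero_of_lt_abs {f : L2} (hf : f ∈ testFunctions S E) :
    ∃ R : ℝ, ∀ᵐ γ : ℝ, R < |γ| → hat f γ = 0 := by
  obtain ⟨-, K, hK, -, hfK⟩ := hf
  obtain ⟨R, hR⟩ := hK.isBounded.subset_closedBall 0
  refine ⟨R, ?_⟩
  filter_upwards [hfK] with γ h1 h2
  refine h1 fun h => ?_
  have := hR h
  rw [Metric.mem_closedBall, dist_zero_right, Real.norm_eq_abs] at this
  exact absurd this (not_le.2 h2)

theorem exceptionalSets.ae_notMem (hE : E ∈ exceptionalSets S) : ∀ᵐ γ : ℝ, γ ∉ E :=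
  measure_eq_zero_iff_ae_notMem.1 (measure_mono_null subset_closure hE.2.2)

/-- If `y` is orthogonal to all test functions, indicators force its transform to vanish a.e. on `S
\ E`. As `E` is null, `y` is then orthogonal to the whole space, and the double orthogonal
complement is the closure. -/
theorem L2check_subset_closure_testFunctions (hS : MeasurableSet S)
    (hE : E ∈ exceptionalSets S) : (L2check S : Set L2) ⊆ closure (testFunctions S E) := by
  intro x hx
  have hx' : ∀ᵐ γ : ℝ, γ ∉ S → hat x γ = 0 := hx
  change x ∈ (testSubmodule S E).topologicalClosure
  rw [← Submodule.orthogonal_orthogonal_eq_closure, Submodule.mem_orthogonal]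
  intro y hy
  rw [Submodule.mem_orthogonal] at hy
  have h1 : ∀ᵐ γ : ℝ, γ ∈ S \ E → hat y γ = 0 := by
    refine ae_eq_zero_of_forall_setIntegral_subset_isCompact (hS.diff hE.1)
      ((hat_memLp y).locallyIntegrable (by norm_num)) fun K hKS hK A hAK hA => ?_
    obtain ⟨f, hf⟩ := exists_hat_ae_eq (memLp_indicator_one hA
      (measure_ne_top_of_subset hAK hK.measure_lt_top.ne) (p := 2))
    have h2 := hy f (mem_testFunctions_of_hat_ae_eq_indicator hK hKS hA hAK hf)
    rw [inner_eq_integral_hat] at h2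
    rw [← integral_indicator hA, ← h2]
    refine integral_congr_ae ?_
    filter_upwards [hf] with γ hγ
    rw [hγ]
    by_cases h : γ ∈ A <;> simp [h]
  rw [inner_eq_integral_hat]
  refine integral_eq_zero_of_ae ?_
  filter_upwards [h1, hx', exceptionalSets.ae_notMem hE] with γ h2 h3 h4
  by_cases h : γ ∈ S
  · simp [h2 ⟨h, h4⟩]
  · simp [h3 h]

end TestFunctions

/-! ### Uniqueness of coefficients in series of characters. -/

section AlmostPeriodic

open Filter Topology

theorem norm_integral_character_le {β : ℝ} (hβ : β ≠ 0) (N : ℝ) :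
    ‖∫ u in (0 : ℝ)..N, character β u‖ ≤ 2 / ‖(2 * Real.pi * Complex.I * β : ℂ)‖ := by
  have hne : (2 * Real.pi * Complex.I * β : ℂ) ≠ 0 := by
    simp [Real.pi_ne_zero, hβ]
  simp only [character]
  rw [integral_exp_mul_complex hne, norm_div]
  gcongr
  refine (norm_sub_le _ _).trans_eq ?_
  have h1 := norm_character β N
  have h2 := norm_character β 0
  rw [character] at h1 h2
  rw [h1, h2]
  norm_num

/-- For `β ≠ 0` the integrals stay bounded, so the means are O(1/N); means therefore detect
frequency zero. -/
theorem tendsto_mean_character (β : ℝ) :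
    Tendsto (fun N : ℕ => ((N : ℂ)⁻¹ * ∫ u in (0 : ℝ)..N, character β u)) atTop
      (𝓝 (if β = 0 then 1 else 0)) := by
  split_ifs with hβ
  · refine tendsto_const_nhds.congr' ?_
    filter_upwards [eventually_ne_atTop 0] with N hN
    have : ∀ u, character β u = 1 := fun u => by rw [hβ, character_comm, character_zero]
    simp [this, hN]
  · refine squeeze_zero_norm (a := fun N : ℕ => (N : ℝ)⁻¹ *
      (2 / ‖(2 * Real.pi * Complex.I * β : ℂ)‖)) (fun N => ?_) ?_
    · rw [norm_mul, norm_inv, Complex.norm_natCast]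
      gcongr
      exact norm_integral_character_le hβ N
    · simpa using tendsto_inv_atTop_nhds_zero_nat.mul_const
        (2 / ‖(2 * Real.pi * Complex.I * β : ℂ)‖)

theorem norm_mean_character_le (β : ℝ) (N : ℕ) :
    ‖((N : ℂ)⁻¹ * ∫ u in (0 : ℝ)..N, character β u)‖ ≤ 1 := by
  rw [norm_mul, norm_inv, Complex.norm_natCast]
  have h := intervalIntegral.norm_integral_le_of_norm_le_const (a := (0 : ℝ)) (b := N) (C := 1)
    (f := character β) (fun u _ => (norm_character β u).le)
  rw [sub_zero, one_mul, abs_of_nonneg (Nat.cast_nonneg N)] at h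
  refine (mul_le_mul_of_nonneg_left h (by positivity)).trans ?_
  exact inv_mul_le_one

/-- The coefficients of an absolutely convergent series of characters are unique: if the series is
constant, only the constant character contributes. -/
theorem coeff_eq_of_hasSum_character {ι : Type*} [Countable ι] {freq : ι → ℝ}
    (hfreq : Function.Injective freq) {d : ι → ℂ} {C : ℂ}
    (h : ∀ u : ℝ, HasSum (fun i => character (freq i) u * d i) C) (i : ι) :
    d i = if freq i = 0 then C else 0 := by
  classical
  have hd : Summable fun i => ‖d i‖ := by
    have := (h 0).summable.norm
    simpa using this
  -- Demodulating moves the `i`-th frequency to zero, so the mean over `[0, N]` isolates `d i` in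
  -- the limit. The summable `‖d k‖` dominates both limit interchanges.
  have h1 : ∀ u : ℝ, HasSum (fun k => character (freq k - freq i) u * d k)
      (character (-freq i) u * C) := fun u => by
    refine ((h u).mul_left (character (-freq i) u)).congr_fun ?_
    intro k
    rw [character_comm (freq k - freq i), sub_eq_add_neg, character_add, character_comm u,
      character_comm u]
    ring
  have h2 : ∀ N : ℕ, HasSum (fun k => ((N : ℂ)⁻¹ * ∫ u in (0 : ℝ)..N,
      character (freq k - freq i) u) * d k)
      (((N : ℂ)⁻¹ * ∫ u in (0 : ℝ)..N, character (-freq i) u) * C) := fun N => by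
    have := intervalIntegral.hasSum_integral_of_dominated_convergence (μ := volume)
      (a := 0) (b := N) (F := fun k u => character (freq k - freq i) u * d k)
      (f := fun u => character (-freq i) u * C) (fun k _ => ‖d k‖)
      (fun k => by fun_prop) (fun k => .of_forall fun u _ => by simp)
      (.of_forall fun u _ => hd) (by simp) (.of_forall fun u _ => h1 u)
    simp only [intervalIntegral.integral_mul_const] at this
    simpa only [mul_assoc] using this.mul_left ((N : ℂ)⁻¹)
  have h3 : Tendsto (fun N : ℕ => ∑' k, ((N : ℂ)⁻¹ * ∫ u in (0 : ℝ)..N,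
      character (freq k - freq i) u) * d k) atTop
      (𝓝 (∑' k, (if freq k - freq i = 0 then 1 else 0) * d k)) := by
    refine tendsto_tsum_of_dominated_convergence hd
      (fun k => (tendsto_mean_character _).mul_const _) (.of_forall fun N k => ?_)
    rw [norm_mul]
    exact mul_le_of_le_one_left (norm_nonneg _) (norm_mean_character_le _ _)
  have h4 : ∑' k, (if freq k - freq i = 0 then 1 else 0) * d k = d i := by
    rw [tsum_eq_single i fun k hk => ?_]
    · simp
    · rw [if_neg (sub_ne_zero.2 (hfreq.ne hk)), zero_mul]
  rw [h4] at h3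
  simp only [(h2 _).tsum_eq] at h3
  have h5 := tendsto_nhds_unique h3 ((tendsto_mean_character (-freq i)).mul_const C)
  rw [h5]
  simp

end AlmostPeriodic

/-! ### The functions t_α and the frequency expansion. -/

section Autocorrelation

open Filter Topology

theorem aestronglyMeasurable_of_hasSum_ae {ι : Type*} [Countable ι] {F : ι → ℝ → ℂ} {G : ℝ → ℂ}
    (hF : ∀ i, AEStronglyMeasurable (F i) volume)
    (h : ∀ᵐ γ : ℝ, HasSum (fun i => F i γ) (G γ)) : AEStronglyMeasurable G volume :=
  aestronglyMeasurable_of_tendsto_ae atTop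
    (fun s => Finset.aestronglyMeasurable_fun_sum s fun i _ => hF i) h

theorem aestronglyMeasurable_comp_add {F : ℝ → ℂ} (hF : AEStronglyMeasurable F volume) (a : ℝ) :
    AEStronglyMeasurable (fun γ => F (γ + a)) volume :=
  hF.comp_measurePreserving (measurePreserving_add_right volume a)

variable {J : Type*} (c : J → ℝ) (g h : J → L2)

/-- One summand of the function `t_α`. -/
def autoTerm (α : ℝ) (j : J) (γ : ℝ) : ℂ :=
  (((c j)⁻¹ : ℝ) : ℂ) * conj (hat (g j) γ) * hat (h j) (γ + α)

/-- The function `t_α`, the sum over those `j` for which `α` lies in the dual lattice. -/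
def autocorr (α γ : ℝ) : ℂ := ∑' j : {j : J // α ∈ dualLattice (c j)}, autoTerm c g h α j γ

/-- The coefficient of frequency `α` in the almost periodic expansion. -/
def freqCoeff (f : L2) (α : ℝ) : ℂ :=
  ∫ γ, hat f γ * conj (hat f (γ + α)) * autocorr c g h α γ

variable {c g h}

theorem aestronglyMeasurable_autoTerm (α : ℝ) (j : J) :
    AEStronglyMeasurable (autoTerm c g h α j) volume :=
  (aestronglyMeasurable_const.mul (hat_memLp (g j)).star.1).mul
    (aestronglyMeasurable_comp_add (hat_memLp (h j)).1 α)

theorem autoTerm_ae_eq_zero {S : Set ℝ} (hg : ∀ p, gsi c g p ∈ L2check S)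
    (hh : ∀ p, gsi c h p ∈ L2check S) (α : ℝ) (j : J) :
    ∀ᵐ γ : ℝ, ¬ (γ ∈ S ∧ γ + α ∈ S) → autoTerm c g h α j γ = 0 := by
  filter_upwards [hat_eq_zero_of_gsi_mem hg j, ae_add_right (hat_eq_zero_of_gsi_mem hh j) α]
    with γ h1 h2 h3
  rw [not_and_or] at h3
  rcases h3 with h3 | h3
  · simp [autoTerm, h1 h3]
  · simp [autoTerm, h2 h3]

theorem crossTerm_eq_integral (f : L2) (j : J) (m : ℤ) :
    crossTerm (c j) f (g j) (h j) m =
      ∫ γ, (hat f γ * conj (hat f (γ + (c j)⁻¹ * m))) * autoTerm c g h ((c j)⁻¹ * m) j γ := by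
  rw [crossTerm, ← integral_const_mul]
  refine integral_congr_ae (.of_forall fun γ => ?_)
  simp only [autoTerm, map_mul]
  ring

/-- The local integrability condition bounds the sum of the norms, which legitimizes the regrouping
by frequency. -/
theorem summable_crossTerm {S E : Set ℝ} (hc : ∀ j, 0 < c j) (hLIC : DualAlphaLIC S E c g h)
    {f : L2} (hf : f ∈ testFunctions S E) :
    Summable fun p : J × ℤ => crossTerm (c p.1) f (g p.1) (h p.1) p.2 := by
  refine Summable.of_enorm (ne_of_lt (lt_of_le_of_lt ?_ (hLIC f hf)))
  rw [ENNReal.tsum_prod (f := fun j m => ‖crossTerm (c j) f (g j) (h j) m‖ₑ)]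
  refine ENNReal.tsum_le_tsum fun j => ENNReal.tsum_le_tsum fun m => ?_
  rw [crossTerm, enorm_mul]
  gcongr
  · rw [← ofReal_norm, Complex.norm_real, Real.norm_of_nonneg (inv_pos.2 (hc j)).le]
  · exact enorm_integral_le_lintegral_enorm _

variable [Countable J] {S : Set ℝ}

/-- By 2ab ≤ a² + b², the series is dominated by the Calderón sums of `g` at γ and of `h` at γ + α,
with a constant independent of α. -/
theorem exists_tsum_norm_autoTerm_le (hS : MeasurableSet S) (hc : ∀ j, 0 < c j)
    (hg : IsBessel (L2check S) (gsi c g)) (hh : IsBessel (L2check S) (gsi c h)) :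
    ∃ C : ℝ, ∀ α : ℝ, ∀ᵐ γ : ℝ,
      Summable (fun j : {j : J // α ∈ dualLattice (c j)} => ‖autoTerm c g h α j γ‖) ∧
      ∑' j : {j : J // α ∈ dualLattice (c j)}, ‖autoTerm c g h α j γ‖ ≤ C := by
  obtain ⟨B, hB⟩ := hg.exists_forall_sum_le hS hc
  obtain ⟨B', hB'⟩ := hh.exists_forall_sum_le hS hc
  refine ⟨(B + B') / 2, fun α => ?_⟩
  filter_upwards [hB, ae_add_right hB' α] with γ h1 h2
  have key : ∀ s : Finset {j : J // α ∈ dualLattice (c j)},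
      ∑ j ∈ s, ‖autoTerm c g h α j γ‖ ≤ (B + B') / 2 := by
    intro s
    have h3 := h1 (s.map (Function.Embedding.subtype _))
    have h4 := h2 (s.map (Function.Embedding.subtype _))
    rw [Finset.sum_map] at h3 h4
    have h5 : ∑ j ∈ s, ‖autoTerm c g h α j γ‖ ≤ ∑ j ∈ s, ((c j)⁻¹ * ‖hat (g j) γ‖ ^ 2 +
        (c j)⁻¹ * ‖hat (h j) (γ + α)‖ ^ 2) / 2 := by
      refine Finset.sum_le_sum fun j _ => ?_
      have hcj : 0 < (c j)⁻¹ := inv_pos.2 (hc j)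
      rw [autoTerm, norm_mul, norm_mul, Complex.norm_real, RCLike.norm_conj, Real.norm_eq_abs,
        abs_of_pos hcj]
      nlinarith [mul_nonneg hcj.le (sq_nonneg (‖hat (g j) γ‖ - ‖hat (h j) (γ + α)‖))]
    rw [← Finset.sum_div, Finset.sum_add_distrib] at h5
    simp only [Function.Embedding.subtype_apply] at h3 h4
    linarith
  exact ⟨summable_of_sum_le (fun _ => norm_nonneg _) key,
    Real.tsum_le_of_sum_le (fun _ => norm_nonneg _) key⟩

theorem hasSum_autocorr (hS : MeasurableSet S) (hc : ∀ j, 0 < c j)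
    (hg : IsBessel (L2check S) (gsi c g)) (hh : IsBessel (L2check S) (gsi c h)) (α : ℝ) :
    ∀ᵐ γ : ℝ, HasSum (fun j : {j : J // α ∈ dualLattice (c j)} => autoTerm c g h α j γ)
      (autocorr c g h α γ) := by
  obtain ⟨C, hC⟩ := exists_tsum_norm_autoTerm_le hS hc hg hh
  filter_upwards [hC α] with γ hγ
  exact hγ.1.of_norm.hasSum

theorem aestronglyMeasurable_autocorr (hS : MeasurableSet S) (hc : ∀ j, 0 < c j)
    (hg : IsBessel (L2check S) (gsi c g)) (hh : IsBessel (L2check S) (gsi c h)) (α : ℝ) :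
    AEStronglyMeasurable (autocorr c g h α) volume :=
  aestronglyMeasurable_of_hasSum_ae
    (F := fun (j : {j : J // α ∈ dualLattice (c j)}) γ => autoTerm c g h α j γ)
    (fun j => aestronglyMeasurable_autoTerm α (j : J))
    (hasSum_autocorr hS hc hg hh α)

theorem exists_norm_autocorr_le (hS : MeasurableSet S) (hc : ∀ j, 0 < c j)
    (hg : IsBessel (L2check S) (gsi c g)) (hh : IsBessel (L2check S) (gsi c h)) :
    ∃ C : ℝ, ∀ α : ℝ, ∀ᵐ γ : ℝ, ‖autocorr c g h α γ‖ ≤ C := by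
  obtain ⟨C, hC⟩ := exists_tsum_norm_autoTerm_le hS hc hg hh
  refine ⟨C, fun α => ?_⟩
  filter_upwards [hC α] with γ hγ
  exact (norm_tsum_le_tsum_norm hγ.1).trans hγ.2

theorem autocorr_ae_eq_zero (hg : ∀ p, gsi c g p ∈ L2check S) (hh : ∀ p, gsi c h p ∈ L2check S)
    (α : ℝ) : ∀ᵐ γ : ℝ, ¬ (γ ∈ S ∧ γ + α ∈ S) → autocorr c g h α γ = 0 := by
  filter_upwards [ae_all_iff.2 (autoTerm_ae_eq_zero hg hh α)] with γ hγ h1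
  rw [autocorr]
  simp only [hγ _ h1, tsum_zero]

/-- An absolutely integrable weight may be integrated termwise against `t_α`. -/
theorem hasSum_integral_mul_autoTerm (hS : MeasurableSet S) (hc : ∀ j, 0 < c j)
    (hg : IsBessel (L2check S) (gsi c g)) (hh : IsBessel (L2check S) (gsi c h)) (α : ℝ)
    {w : ℝ → ℂ} (hw : Integrable w) :
    HasSum (fun j : {j : J // α ∈ dualLattice (c j)} => ∫ γ, w γ * autoTerm c g h α j γ)
      (∫ γ, w γ * autocorr c g h α γ) := by
  obtain ⟨C, hC⟩ := exists_tsum_norm_autoTerm_le hS hc hg hh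
  have hmeas : ∀ j : {j : J // α ∈ dualLattice (c j)},
      AEStronglyMeasurable (fun γ => w γ * autoTerm c g h α j γ) volume := fun j =>
    hw.1.mul (aestronglyMeasurable_autoTerm α (j : J))
  refine hasSum_integral_of_dominated_convergence
    (fun j γ => ‖w γ * autoTerm c g h α j γ‖) hmeas (fun j => .of_forall fun _ => le_rfl) ?_ ?_ ?_
  · filter_upwards [hC α] with γ hγ
    simpa only [norm_mul] using hγ.1.mul_left _
  · refine Integrable.mono' (hw.norm.mul_const C) ?_ ?_
    · have : AEStronglyMeasurable (fun γ => ((∑' j : {j : J // α ∈ dualLattice (c j)},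
          ‖w γ * autoTerm c g h α j γ‖ : ℝ) : ℂ)) volume := by
        refine aestronglyMeasurable_of_hasSum_ae
          (F := fun (j : {j : J // α ∈ dualLattice (c j)}) γ => ((‖w γ * autoTerm c g h α j γ‖ : ℝ) : ℂ))
          (fun j => Complex.continuous_ofReal.comp_aestronglyMeasurable (hmeas j).norm) ?_
        filter_upwards [hC α] with γ hγ
        rw [Complex.hasSum_ofReal]
        simp only [norm_mul]
        exact (hγ.1.mul_left _).hasSum
      simpa using this.re
    · filter_upwards [hC α] with γ hγ
      rw [Real.norm_of_nonneg (tsum_nonneg fun _ => norm_nonneg _)]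
      simp only [norm_mul]
      rw [tsum_mul_left]
      gcongr
      exact hγ.2
  · filter_upwards [hasSum_autocorr hS hc hg hh α] with γ hγ
    exact hγ.mul_left _

theorem integrable_hat_mul_conj_hat_add (f k : L2) (α : ℝ) :
    Integrable fun γ => hat f γ * conj (hat k (γ + α)) :=
  (hat_memLp f).integrable_mul (memLp_comp_add (hat_memLp k) α).star

variable (c) in
/-- The union of the dual lattices. -/
def frequencies : Set ℝ := ⋃ j, dualLattice (c j)

instance : Countable (frequencies c) :=
  (Set.countable_iUnion fun _ => Set.countable_range _).to_subtype

/-- The diagonal of the mixed frame form, expanded over the frequencies. -/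
theorem hasSum_freqCoeff {E : Set ℝ} (hS : MeasurableSet S) (hc : ∀ j, 0 < c j)
    (hg : IsBessel (L2check S) (gsi c g)) (hh : IsBessel (L2check S) (gsi c h))
    (hLIC : DualAlphaLIC S E c g h) {f : L2} (hf : f ∈ testFunctions S E) {X : ℂ}
    (hX : HasSum (fun p => inner ℂ (gsi c g p) f * inner ℂ f (gsi c h p)) X) :
    HasSum (fun α : frequencies c => freqCoeff c g h f α) X := by
  obtain ⟨R, hR⟩ := exists_ae_hat_eq_zero_of_lt_abs hf
  choose Y hY1 hY2 using fun j => exists_hasSum_crossTerm (hc j) (g j) (h j) hf.1 hR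
  have h1 : HasSum Y X := hX.prod_fiberwise hY1
  -- For each `j`, summing over `k` or over `m` gives the same `Y j`, so the two double series have
  -- equal totals.
  have h2 : HasSum (fun p : J × ℤ => crossTerm (c p.1) f (g p.1) (h p.1) p.2) X := by
    have h3 := (summable_crossTerm hc hLIC hf).hasSum
    rwa [(h3.prod_fiberwise hY2).unique h1] at h3
  let q : J × ℤ → frequencies c := fun p =>
    ⟨(c p.1)⁻¹ * p.2, Set.mem_iUnion.2 ⟨p.1, Set.mem_range_self _⟩⟩
  refine HasSum.sigma ((Equiv.sigmaFiberEquiv q).hasSum_iff.2 h2) fun α => ?_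
  -- Since `c j ≠ 0`, `m` is determined by `j` and `α`, so a fibre of `q` is the index set of t_α.
  let e : {p : J × ℤ // q p = α} ≃ {j : J // (α : ℝ) ∈ dualLattice (c j)} :=
    Equiv.ofBijective (fun p => ⟨p.1.1, p.1.2, congrArg Subtype.val p.2⟩) (by
      constructor
      · rintro ⟨⟨j, m⟩, hp⟩ ⟨⟨j', m'⟩, hp'⟩ hjj
        obtain rfl : j = j' := congrArg Subtype.val hjj
        have h3 : (c j)⁻¹ * (m : ℝ) = (c j)⁻¹ * m' :=
          congrArg Subtype.val (hp.trans hp'.symm)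
        have h4 := mul_left_cancel₀ (inv_pos.2 (hc j)).ne' h3
        have h5 : m = m' := by exact_mod_cast h4
        subst h5
        rfl
      · rintro ⟨j, m, hm⟩
        exact ⟨⟨(j, m), Subtype.ext hm⟩, rfl⟩)
  have h3 := e.hasSum_iff.2 (hasSum_integral_mul_autoTerm hS hc hg hh α
    (integrable_hat_mul_conj_hat_add f f α))
  refine h3.congr_fun fun p => ?_
  have hp : (c p.1.1)⁻¹ * (p.1.2 : ℝ) = α := congrArg Subtype.val p.2
  simp only [Function.comp_apply, Equiv.sigmaFiberEquiv, Equiv.coe_fn_mk, crossTerm_eq_integral,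
    hp]
  rfl

end Autocorrelation

/-! ### From the expansion to the equations for t_α, and back. -/

section Characterization

theorem norm_translate (a : ℝ) (f : L2) : ‖translate a f‖ = ‖f‖ :=
  Lp.norm_compMeasurePreserving f (measurePreserving_sub_right volume a)

theorem translate_mem_testFunctions {S E : Set ℝ} (a : ℝ) {f : L2} (hf : f ∈ testFunctions S E) :
    translate a f ∈ testFunctions S E := by
  obtain ⟨hf, K, hK, hKS, hfK⟩ := hf
  refine ⟨(memLp_congr_ae (hat_translate a f)).2 (memLp_character_mul _ hf), K, hK, hKS, ?_⟩
  filter_upwards [hat_translate a f, hfK] with γ h1 h2 h3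
  rw [h1, h2 h3, mul_zero]

variable {J : Type*} {c : J → ℝ} {g h : J → L2}

theorem freqCoeff_translate (u : ℝ) (f : L2) (α : ℝ) :
    freqCoeff c g h (translate u f) α = character α u * freqCoeff c g h f α := by
  rw [freqCoeff, freqCoeff, ← integral_const_mul]
  refine integral_congr_ae ?_
  filter_upwards [hat_translate u f, ae_add_right (hat_translate u f) α] with γ h1 h2
  rw [h1, h2, map_mul, conj_character, neg_neg, character_add, character_comm α u]
  linear_combination (hat f γ * character u α * conj (hat f (γ + α)) * autocorr c g h α γ) *
    character_neg_mul u γ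

variable [Countable J] {S E : Set ℝ}

/-- Along the translates of `f`, the expansion is a series of characters in `u` with constant sum
`‖f‖ ^ 2`. -/
theorem freqCoeff_eq_of_hasSum (hS : MeasurableSet S) (hc : ∀ j, 0 < c j)
    (hg : IsBessel (L2check S) (gsi c g)) (hh : IsBessel (L2check S) (gsi c h))
    (hLIC : DualAlphaLIC S E c g h)
    (hsum : ∀ f ∈ testFunctions S E,
      HasSum (fun p => inner ℂ (gsi c g p) f * inner ℂ f (gsi c h p)) ((‖f‖ : ℂ) ^ 2))
    {f : L2} (hf : f ∈ testFunctions S E) {α : ℝ} (hα : α ∈ frequencies c) :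
    freqCoeff c g h f α = if α = 0 then (‖f‖ : ℂ) ^ 2 else 0 := by
  refine coeff_eq_of_hasSum_character (freq := fun α : frequencies c => (α : ℝ))
    Subtype.val_injective (d := fun α => freqCoeff c g h f α) (fun u => ?_) ⟨α, hα⟩
  have hu := translate_mem_testFunctions u hf
  have := hasSum_freqCoeff hS hc hg hh hLIC hu (hsum _ hu)
  simpa only [freqCoeff_translate, norm_translate] using this

theorem hasSum_of_autocorr_eq [Nonempty J] (hS : MeasurableSet S) (hc : ∀ j, 0 < c j)
    (hg : IsBessel (L2check S) (gsi c g)) (hh : IsBessel (L2check S) (gsi c h))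
    (hLIC : DualAlphaLIC S E c g h)
    (hauto : ∀ α ∈ frequencies c, ∀ᵐ γ : ℝ,
      autocorr c g h α γ = if α = 0 then S.indicator (fun _ => (1 : ℂ)) γ else 0)
    {f : L2} (hf : f ∈ testFunctions S E) :
    HasSum (fun p => inner ℂ (gsi c g p) f * inner ℂ f (gsi c h p)) ((‖f‖ : ℂ) ^ 2) := by
  have hfV : ∀ᵐ γ : ℝ, γ ∉ S → hat f γ = 0 := testFunctions_subset_L2check hf
  -- The Bessel property alone gives convergence; the frequency expansion then identifies the limit.
  have hX := hg.hasSum_inner_analysis hh ⟨f, hfV⟩ ⟨f, hfV⟩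
  have h1 := hasSum_freqCoeff hS hc hg hh hLIC hf hX
  obtain ⟨j⟩ := ‹Nonempty J›
  have h0 : (0 : ℝ) ∈ frequencies c := Set.mem_iUnion.2 ⟨j, 0, by simp⟩
  have h2 : freqCoeff c g h f 0 = (‖f‖ : ℂ) ^ 2 := by
    rw [norm_sq_eq_integral_hat, freqCoeff]
    refine integral_congr_ae ?_
    filter_upwards [hauto 0 h0, hfV] with γ h3 h4
    rw [h3, if_pos rfl, add_zero]
    by_cases hγ : γ ∈ S
    · simp [hγ, mul_comm]
    · simp [h4 hγ]
  have h3 : ∀ α : frequencies c, α ≠ ⟨0, h0⟩ → freqCoeff c g h f α = 0 := by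
    intro α hα
    refine integral_eq_zero_of_ae ?_
    filter_upwards [hauto α α.2] with γ h4
    rw [h4, if_neg fun h => hα (Subtype.ext h), mul_zero]
    rfl
  rw [h1.unique (hasSum_single _ h3), h2] at hX
  exact hX

/-- Polarization of the vanishing of the coefficient of frequency `α`. -/
theorem integral_mul_autocorr_eq_zero (hS : MeasurableSet S) (hc : ∀ j, 0 < c j)
    (hg : IsBessel (L2check S) (gsi c g)) (hh : IsBessel (L2check S) (gsi c h)) {α : ℝ}
    (hα : ∀ f ∈ testFunctions S E, freqCoeff c g h f α = 0) {f k : L2}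
    (hf : f ∈ testFunctions S E) (hk : k ∈ testFunctions S E) :
    ∫ γ, hat f γ * conj (hat k (γ + α)) * autocorr c g h α γ = 0 := by
  obtain ⟨C, hC⟩ := exists_norm_autocorr_le hS hc hg hh
  have hint : ∀ f k : L2, Integrable fun γ =>
      hat f γ * conj (hat k (γ + α)) * autocorr c g h α γ := fun f k =>
    (integrable_hat_mul_conj_hat_add f k α).mul_bdd
      (aestronglyMeasurable_autocorr hS hc hg hh α) (hC α)
  have hexp : ∀ a : ℂ, freqCoeff c g h (f + a • k) α = freqCoeff c g h f α +
      conj a * (∫ γ, hat f γ * conj (hat k (γ + α)) * autocorr c g h α γ) +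
      a * (∫ γ, hat k γ * conj (hat f (γ + α)) * autocorr c g h α γ) +
      a * conj a * freqCoeff c g h k α := by
    intro a
    have h1 := hint f f
    have h2 := (hint f k).const_mul (conj a)
    have h3 := (hint k f).const_mul a
    have h4 := (hint k k).const_mul (a * conj a)
    have h12 := h1.add h2
    simp only [Pi.add_def] at h12
    have h123 := h12.add h3
    simp only [Pi.add_def] at h123
    simp only [freqCoeff]
    rw [← integral_const_mul, ← integral_const_mul, ← integral_const_mul, ← integral_add h1 h2,
      ← integral_add h12 h3, ← integral_add h123 h4]
    refine integral_congr_ae ?_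
    filter_upwards [hat_add f (a • k), hat_smul a k, ae_add_right (hat_add f (a • k)) α,
      ae_add_right (hat_smul a k) α] with γ e1 e2 e3 e4
    rw [e1, e2, e3, e4, map_add, map_mul]
    ring
  have hmem : ∀ a : ℂ, f + a • k ∈ testFunctions S E := fun a =>
    (testSubmodule S E).add_mem hf ((testSubmodule S E).smul_mem a hk)
  -- Writing P and Q for the two mixed integrals, `a = 1` gives P + Q = 0 and `a = I` gives -iP + iQ
  -- = 0, so P = 0.
  have h1 := hexp 1
  have hI := hexp Complex.I
  rw [hα _ (hmem _), hα _ hf, hα _ hk] at h1 hI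
  simp only [map_one, Complex.conj_I] at h1 hI
  linear_combination (-1 / 2 : ℂ) * h1 - (Complex.I / 2) * hI + (1 / 2 : ℂ) *
    ((∫ γ, hat f γ * conj (hat k (γ + α)) * autocorr c g h α γ) -
      (∫ γ, hat k γ * conj (hat f (γ + α)) * autocorr c g h α γ)) * Complex.I_sq

theorem locallyIntegrable_autocorr (hS : MeasurableSet S) (hc : ∀ j, 0 < c j)
    (hg : IsBessel (L2check S) (gsi c g)) (hh : IsBessel (L2check S) (gsi c h)) (α : ℝ) :
    LocallyIntegrable (autocorr c g h α) volume := by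
  obtain ⟨C, hC⟩ := exists_norm_autocorr_le hS hc hg hh
  exact (memLp_top_of_bound (aestronglyMeasurable_autocorr hS hc hg hh α) C
    (hC α)).locallyIntegrable le_top

/-- When f̂ is the indicator of `A`, the hypothesis says that t_0 has integral |A| over `A`. -/
theorem autocorr_zero_ae_eq (hS : MeasurableSet S) (hE : E ∈ exceptionalSets S)
    (hc : ∀ j, 0 < c j) (hg : IsBessel (L2check S) (gsi c g))
    (hh : IsBessel (L2check S) (gsi c h))
    (hcoeff : ∀ f ∈ testFunctions S E, freqCoeff c g h f 0 = (‖f‖ : ℂ) ^ 2) :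
    ∀ᵐ γ : ℝ, autocorr c g h 0 γ = S.indicator (fun _ => (1 : ℂ)) γ := by
  have hloc := locallyIntegrable_autocorr hS hc hg hh 0
  have h1 : ∀ᵐ γ : ℝ, γ ∈ S \ E → autocorr c g h 0 γ - 1 = 0 := by
    refine ae_eq_zero_of_forall_setIntegral_subset_isCompact (hS.diff hE.1)
      (hloc.sub (locallyIntegrable_const 1)) fun K hKS hK A hAK hA => ?_
    have hAf : volume A ≠ ∞ := measure_ne_top_of_subset hAK hK.measure_lt_top.ne
    obtain ⟨f, hf⟩ := exists_hat_ae_eq (memLp_indicator_one hA hAf (p := 2))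
    have h2 := hcoeff f (mem_testFunctions_of_hat_ae_eq_indicator hK hKS hA hAK hf)
    have h3 : freqCoeff c g h f 0 = ∫ γ in A, autocorr c g h 0 γ := by
      rw [freqCoeff, ← integral_indicator hA]
      refine integral_congr_ae ?_
      filter_upwards [hf] with γ hγ
      rw [add_zero, hγ]
      by_cases h : γ ∈ A <;> simp [h]
    have h4 := norm_sq_of_hat_eq_indicator hA hf
    rw [integral_sub ((hloc.integrableOn_isCompact hK).mono_set hAK) (integrableOn_const hAf),
      ← h3, h2, setIntegral_const, ← h4]
    simp
  filter_upwards [h1, autocorr_ae_eq_zero hg.1 hh.1 0, exceptionalSets.ae_notMem hE]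
    with γ h2 h3 h4
  by_cases hγ : γ ∈ S
  · rw [Set.indicator_of_mem hγ]
    exact sub_eq_zero.1 (h2 ⟨hγ, h4⟩)
  · rw [Set.indicator_of_notMem hγ]
    exact h3 fun h => hγ h.1

theorem autocorr_ae_eq_zero_of_freqCoeff (hS : MeasurableSet S) (hE : E ∈ exceptionalSets S)
    (hc : ∀ j, 0 < c j) (hg : IsBessel (L2check S) (gsi c g))
    (hh : IsBessel (L2check S) (gsi c h)) {α : ℝ}
    (hcoeff : ∀ f ∈ testFunctions S E, freqCoeff c g h f α = 0) :
    ∀ᵐ γ : ℝ, autocorr c g h α γ = 0 := by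
  have hmeas : MeasurableSet ((S \ E) ∩ (fun γ => γ + α) ⁻¹' (S \ E)) :=
    (hS.diff hE.1).inter ((measurable_add_const α) (hS.diff hE.1))
  have h1 := ae_eq_zero_of_forall_setIntegral_subset_isCompact hmeas
    (locallyIntegrable_autocorr hS hc hg hh α) fun K hKS hK A hAK hA => by
      have hAf : volume A ≠ ∞ := measure_ne_top_of_subset hAK hK.measure_lt_top.ne
      -- This set is A + α. With f̂ = 1_A and k̂ = 1_{A+α}, the weight f̂(γ) conj k̂(γ+α) is 1_A, so
      -- the polarized identity reads ∫_A t_α = 0.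
      have hA' : MeasurableSet ((fun γ => γ - α) ⁻¹' A) := (measurable_sub_const α) hA
      have hK' : IsCompact ((fun γ => γ + α) '' K) := hK.image (by fun_prop)
      have hAK' : (fun γ => γ - α) ⁻¹' A ⊆ (fun γ => γ + α) '' K := fun γ hγ =>
        ⟨γ - α, hAK hγ, by simp⟩
      have hKS' : (fun γ => γ + α) '' K ⊆ S \ E := by
        rintro _ ⟨γ, hγ, rfl⟩
        exact (hKS hγ).2
      obtain ⟨f, hf⟩ := exists_hat_ae_eq (memLp_indicator_one hA hAf (p := 2))
      obtain ⟨k, hk⟩ := exists_hat_ae_eq (memLp_indicator_one hA'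
        (measure_ne_top_of_subset hAK' hK'.measure_lt_top.ne) (p := 2))
      have h2 := integral_mul_autocorr_eq_zero hS hc hg hh hcoeff
        (mem_testFunctions_of_hat_ae_eq_indicator hK (hKS.trans Set.inter_subset_left) hA hAK hf)
        (mem_testFunctions_of_hat_ae_eq_indicator hK' hKS' hA' hAK' hk)
      rw [← h2, ← integral_indicator hA]
      refine integral_congr_ae ?_
      filter_upwards [hf, ae_add_right hk α] with γ h3 h4
      rw [h3, h4]
      by_cases h : γ ∈ A <;> simp [h, Set.indicator]
  filter_upwards [h1, autocorr_ae_eq_zero hg.1 hh.1 α, exceptionalSets.ae_notMem hE,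
    ae_add_right (exceptionalSets.ae_notMem hE) α] with γ h2 h3 h4 h5
  by_cases hγ : γ ∈ S ∧ γ + α ∈ S
  · exact h2 ⟨⟨hγ.1, h4⟩, hγ.2, h5⟩
  · exact h3 hγ

end Characterization

end GSI

end

theorem mainTheorem6 {J : Type*} [Countable J] [Nonempty J]
    (S : Set ℝ) (hS : MeasurableSet S)
    (c : J → ℝ) (hc : ∀ j, 0 < c j) (g h : J → GSI.L2)
    (hg : GSI.IsBessel (GSI.L2check S) (GSI.gsi c g))
    (hh : GSI.IsBessel (GSI.L2check S) (GSI.gsi c h))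
    (hLIC : ∃ E ∈ GSI.exceptionalSets S, GSI.DualAlphaLIC S E c g h) :
    GSI.AreDualFrames (GSI.L2check S) (GSI.gsi c g) (GSI.gsi c h) ↔
      ∀ α ∈ ⋃ j, GSI.dualLattice (c j), ∀ᵐ γ : ℝ,
        HasSum
          (fun j : {j : J // α ∈ GSI.dualLattice (c j)} =>
            (((c j)⁻¹ : ℝ) : ℂ) * conj (GSI.hat (g j) γ) * GSI.hat (h j) (γ + α))
          (if α = 0 then S.indicator (fun _ => (1 : ℂ)) γ else 0) := by
  obtain ⟨E, hE, hLIC⟩ := hLIC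
  -- Completeness provides the adjoints that define the mixed frame operator.
  have : CompleteSpace (GSI.L2check S) := (GSI.isClosed_L2check hS).completeSpace_coe
  rw [hg.areDualFrames_iff hh GSI.testFunctions_subset_L2check
    (GSI.L2check_subset_closure_testFunctions hS hE)]
  constructor
  · intro hsum α hα
    have hcoeff : ∀ f ∈ GSI.testFunctions S E, GSI.freqCoeff c g h f α = _ := fun f hf =>
      GSI.freqCoeff_eq_of_hasSum hS hc hg hh hLIC hsum hf hα
    have hauto : ∀ᵐ γ : ℝ, GSI.autocorr c g h α γ =
        if α = 0 then S.indicator (fun _ => (1 : ℂ)) γ else 0 := by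
      by_cases h0 : α = 0
      · subst h0
        simp only [if_true] at hcoeff ⊢
        exact GSI.autocorr_zero_ae_eq hS hE hc hg hh hcoeff
      · simp only [if_neg h0] at hcoeff ⊢
        exact GSI.autocorr_ae_eq_zero_of_freqCoeff hS hE hc hg hh hcoeff
    filter_upwards [hauto, GSI.hasSum_autocorr hS hc hg hh α] with γ h1 h2
    rwa [h1] at h2
  · intro hT f hf
    refine GSI.hasSum_of_autocorr_eq hS hc hg hh hLIC (fun α hα => ?_) hf
    filter_upwards [hT α hα] with γ hγ
    exact hγ.tsum_eq
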